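/- Let $M$ be a loopless oriented matroid of rank $d$ on a finite set $E$, with covector set $\mathcal L\subseteq\{0,+,-\}^E$ and set of topes $\mathcal T$ (the maximal covectors, for the order induced by $0<\pm$). For sign vectors, $(X\circ Y)_e$ is $X_e$ if $X_e\neq0$ and $Y_e$ otherwise, and $X\setminus F$ is $X$ with the coordinates in $F$ set to $0$. Flats are the sets $E\setminus\operatorname{supp}(L)$, $L\in\mathcal L$, and $\dim L$ is the rank of this flat in the underlying matroid. For $v\in(\mathbb Z/2)^E$ let $T_v=((-1)^{v_e})_{e\in E}$. *Salvetti complex.* $\mathrm{Sal}_M$ is the regular CW complex with cells $Z(L,T)=Z(L,L\circ T)$, $L\in\mathcal L$, $T\in\mathcal T$, of dimension $\dim L$; the faces of $Z(L,T)$ are the cells $Z(L',L'\circ T)$ with $L'\ge L$. Thus $C_i(\mathrm{Sal}_M;\mathbb Z/2)$ is spanned by the $i$-cells, and $\partial Z(L,T)=\sum Z(L',L'\circ T)$ over the covectors $L'>L$ with $\dim L'=\dim L-1$. Conjugation is $\overline{Z(L,T)}=Z(L,-T)$; its fixed cells are the vertices $Z(T,T)$, and $i_*T=Z(T,T)$.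 *Kalinin filtration.* $\mathcal K_p(M)\subseteq(\mathbb Z/2)[\mathcal T]$ is the set of $\gamma$ for which there are $\beta_i\in C_i(\mathrm{Sal}_M;\mathbb Z/2)$, $1\le i\le p$, with $\partial\beta_1=i_*\gamma$ (if $p\ge1$) and $\partial\beta_i=\beta_{i-1}+\overline{\beta_{i-1}}$ for $2\le i\le p$. *Dual degree filtration.* Let $h_e:\mathcal T\to\mathbb Z$ be $1$ if $T_e=+$ and $0$ if $T_e=-$. $\mathcal P^{k}(M)$ consists of $0$ and the functions $\mathcal T\to\mathbb Z$ that are polynomials of degree at most $k$ in the $h_e$ with integer coefficients; $\mathcal P_p(M)\subseteq\mathbb Z[\mathcal T]$ is the annihilator of $\mathcal P^{p-1}(M)$, and $\overline{\mathcal P}_p(M)\subseteq(\mathbb Z/2)[\mathcal T]$ is its reduction mod $2$. *Prefix chains.* Let $\mathcal F:\emptyset=F_0<F_1<\dots<F_d=E$ be a complete flag of flats, let $d_i$ be the indicator vector of $F_i\setminus F_{i-1}$, and let $T_v$ be a tope with $T_v\setminus F_i\in\mathcal L$ for all $i$. For $0\le p\le d$ put $U_{\mathcal F,v,p}=v+\langle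 d_1,\dots,d_p\rangle\subseteq(\mathbb Z/2)^E$ and $\gamma_{\mathcal F,v,p}=\sum_{u\in U_{\mathcal F,v,p}}(-1)^{w(u)}T_u\in\mathbb Z[\mathcal T]$, where $w(u)$ is the number of $d_i$ occurring in $u-v$. **Theorem.** (a) For all such $\mathcal F$, $v$ and $0\le p\le d$, the mod $2$ reduction of $\gamma_{\mathcal F,v,p}$ lies in $\mathcal K_p(M)$. Moreover the chains $\beta_1,\dots,\beta_p$ witnessing this can be chosen so that, if $p\ge1$, $$\beta_p=\sum_{u\in U_{\mathcal F,v,p-1}}Z(T_v\setminus F_p,T_u).$$ (b) For every $p\ge0$, $\overline{\mathcal P}_p(M)\subseteq\mathcal K_p(M)$. -/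

import Mathlib

noncomputable section

open scoped Classical in
/-- Composition of sign vectors: `(X ∘ Y)_e = X_e` if `X_e ≠ 0`, and `Y_e` otherwise. -/
def signComp {E : Type*} (X Y : E → SignType) : E → SignType :=
  fun e => if X e = 0 then Y e else X e

/-- The partial order on sign vectors induced by `0 < +`, `0 < -` (with `+`, `-` incomparable).
It is not the pointwise order coming from the linear order `-1 < 0 < 1` on `SignType`. -/
def SignLE {E : Type*} (X Y : E → SignType) : Prop := ∀ e, X e ≠ 0 → X e = Y e

open scoped Classical in
/-- `X \ F`: the sign vector obtained from `X` by setting all coordinates in `F` to `0`. -/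
def signDelete {E : Type*} (X : E → SignType) (F : Set E) : E → SignType :=
  fun e => if e ∈ F then 0 else X e

/-- The sign vector `T_v` with `(T_v)_e = (-1)^{v_e}`. -/
def signVec {E : Type*} (v : E → ZMod 2) : E → SignType :=
  fun e => if v e = 0 then 1 else -1

/-- An oriented matroid on the ground set `E`, given by its set of covectors. -/
@[ext]
structure OrientedMatroid (E : Type*) where
  /-- the set of covectors -/
  covectors : Set (E → SignType)
  zero_mem : 0 ∈ covectors
  neg_mem : ∀ X ∈ covectors, -X ∈ covectors
  comp_mem : ∀ X ∈ covectors, ∀ Y ∈ covectors, signComp X Y ∈ covectors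
  elimination : ∀ X ∈ covectors, ∀ Y ∈ covectors, ∀ e, X e ≠ 0 → X e = -Y e →
    ∃ Z ∈ covectors, Z e = 0 ∧ ∀ f, ¬ (X f ≠ 0 ∧ X f = -Y f) → Z f = signComp X Y f

namespace OrientedMatroid

variable {E : Type*} (M : OrientedMatroid E)

section Underlying

/-! ### The underlying matroid -/

/-- `e` lies in the closure of `A`: every covector vanishing on `A` vanishes at `e`. -/
def InClosure (A : Set E) (e : E) : Prop :=
  ∀ X ∈ M.covectors, (∀ a ∈ A, X a = 0) → X e = 0

/-- `I` is independent if no `e ∈ I` lies in the closure of `I \ {e}`. -/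
def IndepSet (I : Set E) : Prop := ∀ e ∈ I, ¬ M.InClosure (I \ {e}) e

theorem InClosure.mono {M : OrientedMatroid E} {A B : Set E} (h : A ⊆ B) {e : E}
    (he : M.InClosure A e) : M.InClosure B e :=
  fun X hX h0 => he X hX fun a ha => h0 a (h ha)

theorem InClosure.trans {M : OrientedMatroid E} {A B : Set E}
    (h : ∀ a ∈ A, M.InClosure B a) {e : E} (he : M.InClosure A e) : M.InClosure B e :=
  fun X hX h0 => he X hX fun a ha => h a ha X hX h0

theorem inClosure_of_mem {A : Set E} {e : E} (he : e ∈ A) : M.InClosure A e :=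
  fun _ _ h0 => h0 e he

theorem signType_eq_neg_of_ne {a b : SignType} (ha : a ≠ 0) (hb : b ≠ 0) (h : a ≠ b) :
    a = -b := by
  revert a b; decide

/-- The exchange property of the closure. -/
theorem InClosure.exchange {M : OrientedMatroid E} {A : Set E} {e f : E}
    (h : M.InClosure (insert e A) f) (hf : ¬ M.InClosure A f) :
    M.InClosure (insert f A) e := by
  intro X hX hX0
  by_contra hXe
  simp only [InClosure, not_forall] at hf
  obtain ⟨Y, hY, hY0, hYf⟩ := hf
  have hYe : Y e ≠ 0 := by
    intro h0
    refine hYf (h Y hY ?_)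
    rintro a (rfl | ha)
    exacts [h0, hY0 a ha]
  obtain ⟨W, hW, hWA, hWf, hWe⟩ : ∃ W ∈ M.covectors, (∀ a ∈ A, W a = 0) ∧ W f ≠ 0 ∧
      X e = -W e := by
    by_cases hs : X e = Y e
    · exact ⟨-Y, M.neg_mem Y hY, fun a ha => by simp [hY0 a ha], by simpa using hYf,
        by simp [hs]⟩
    · exact ⟨Y, hY, hY0, hYf, signType_eq_neg_of_ne hXe hYe hs⟩
  obtain ⟨Z, hZ, hZe, hZ'⟩ := M.elimination X hX W hW e hXe hWe
  have hXf : X f = 0 := hX0 f (by simp)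
  have hZf : Z f = W f := by
    rw [hZ' f (by simp [hXf])]
    simp [signComp, hXf]
  refine hWf (hZf ▸ h Z hZ ?_)
  rintro a (rfl | ha)
  · exact hZe
  · have hXa : X a = 0 := hX0 a (by simp [ha])
    rw [hZ' a (by simp [hXa])]
    simp [signComp, hXa, hWA a ha]

theorem IndepSet.insert {M : OrientedMatroid E} {I : Set E} (hI : M.IndepSet I) {x : E}
    (hx : ¬ M.InClosure I x) : M.IndepSet (insert x I) := by
  have hxI : x ∉ I := fun h => hx (M.inClosure_of_mem h)
  rintro e (rfl | he) hcl
  · exact hx (hcl.mono (by intro a; simp; tauto))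
  · have hne : x ≠ e := fun h => hxI (h ▸ he)
    have hset : Insert.insert x I \ {e} = Insert.insert x (I \ {e}) := by
      ext a; simp only [Set.mem_sdiff, Set.mem_insert_iff, Set.mem_singleton_iff]
      constructor
      · tauto
      · rintro (rfl | h)
        · exact ⟨Or.inl rfl, hne⟩
        · exact ⟨Or.inr h.1, h.2⟩
    rw [hset] at hcl
    have h2 := hcl.exchange (hI e he)
    refine hx (h2.mono ?_)
    rintro a (rfl | ha)
    exacts [he, ha.1]

variable [Finite E]

/-- The underlying matroid of an oriented matroid; its flats are the zero sets
of the covectors, see `isFlat_underlyingMatroid_iff`. -/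
def underlyingMatroid : Matroid E :=
  (IndepMatroid.ofBdd (E := Set.univ) (Indep := M.IndepSet)
    (indep_empty := by intro e he; simp at he)
    (indep_subset := by
      intro I J hJ hIJ e he hcl
      exact hJ e (hIJ he) (hcl.mono (Set.sdiff_subset_sdiff_left hIJ)))
    (indep_aug := by
      intro I B hI hImax hB
      by_contra! hcon
      have hBI : ∀ b ∈ B, M.InClosure I b := by
        intro b hb
        by_contra hbI
        exact hcon b ⟨hb, fun h => hbI (M.inClosure_of_mem h)⟩ (hI.insert hbI)
      have hBall : ∀ y, M.InClosure B y := by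
        intro y
        by_contra hy
        exact hy (M.inClosure_of_mem
          (hB.2 (hB.1.insert hy) (Set.subset_insert y B) (Set.mem_insert y B)))
      refine hImax ⟨hI, fun J hJ hIJ y hy => ?_⟩
      by_contra hyI
      refine hJ y hy (((hBall y).trans hBI).mono ?_)
      intro a ha
      exact ⟨hIJ ha, fun h => hyI (h ▸ ha)⟩)
    (subset_ground := fun _ _ => Set.subset_univ _)
    (indep_bdd := ⟨Nat.card E, fun I _ => by
      rw [← (Set.toFinite I).cast_ncard_eq]
      exact_mod_cast Set.ncard_le_card I⟩)).matroid

theorem underlyingMatroid_ground : M.underlyingMatroid.E = Set.univ := rfl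

theorem underlyingMatroid_indep_iff (I : Set E) :
    M.underlyingMatroid.Indep I ↔ M.IndepSet I := Iff.rfl

theorem mem_closure_underlyingMatroid_iff (A : Set E) (e : E) :
    e ∈ M.underlyingMatroid.closure A ↔ M.InClosure A e := by
  obtain ⟨I, hI⟩ := M.underlyingMatroid.exists_isBasis A (by rw [underlyingMatroid_ground]; simp)
  have key : ∀ f, f ∈ M.underlyingMatroid.closure I ↔ M.InClosure I f := by
    intro f
    rw [hI.indep.mem_closure_iff']
    constructor
    · rintro ⟨-, h⟩
      by_contra hf
      exact hf (M.inClosure_of_mem (h (IndepSet.insert hI.indep hf)))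
    · intro h
      refine ⟨Set.mem_univ _, fun hi => ?_⟩
      by_contra hfI
      have hsub : I ⊆ insert f I \ {f} := fun a ha =>
        ⟨Set.mem_insert_of_mem f ha, fun h' => hfI (h' ▸ ha)⟩
      exact hi f (Set.mem_insert f I) (h.mono hsub)
  rw [← hI.closure_eq_closure, key]
  refine ⟨fun h => h.mono hI.subset, fun h => h.trans fun a ha => ?_⟩
  exact (key a).1 (hI.subset_closure ha)

/-- The flats of the underlying matroid are the complements of the supports of the covectors. -/
theorem isFlat_underlyingMatroid_iff (F : Set E) :
    M.underlyingMatroid.IsFlat F ↔ ∃ X ∈ M.covectors, F = {e | X e = 0} := by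
  rw [Matroid.isFlat_iff_closure_eq]
  constructor
  · intro h
    let S : Set (E → SignType) := {X | X ∈ M.covectors ∧ ∀ a ∈ F, X a = 0}
    have hS : S.Nonempty := ⟨0, M.zero_mem, fun _ _ => rfl⟩
    obtain ⟨X, hX, hmin⟩ := Set.exists_min_image S (fun X => {e | X e = 0}.ncard)
      (Set.toFinite S) hS
    refine ⟨X, hX.1, Set.Subset.antisymm (fun a ha => hX.2 a ha) fun e he => ?_⟩
    rw [← h, mem_closure_underlyingMatroid_iff]
    intro Y hY hY0
    by_contra hYe
    have hXY : signComp X Y ∈ S :=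
      ⟨M.comp_mem X hX.1 Y hY, fun a ha => by simp [signComp, hX.2 a ha, hY0 a ha]⟩
    refine absurd (hmin _ hXY) (not_le.2 (Set.ncard_lt_ncard ?_ (Set.toFinite _)))
    refine ⟨fun a ha => ?_, fun hsub => ?_⟩
    · by_contra hXa
      simp only [Set.mem_ofPred_eq] at hXa ha
      simp [signComp, hXa] at ha
    · have := hsub he
      simp only [Set.mem_ofPred_eq] at this he
      simp [signComp, he, hYe] at this
  · rintro ⟨X, hX, rfl⟩
    ext e
    rw [mem_closure_underlyingMatroid_iff]
    exact ⟨fun h => h X hX fun a ha => ha, fun h => M.inClosure_of_mem h⟩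

/-- The rank `d` of the oriented matroid. -/
def rank : ℕ := M.underlyingMatroid.eRank.toNat

/-- The dimension of a covector: the rank of the flat complementary to its support. -/
def covectorDim (X : E → SignType) : ℕ := (M.underlyingMatroid.eRk {e | X e = 0}).toNat

end Underlying

/-! ### Topes and the dual Varchenko-Gelfand filtration -/

/-- A tope is a maximal covector. -/
def IsTope (T : E → SignType) : Prop :=
  T ∈ M.covectors ∧ ∀ X ∈ M.covectors, SignLE T X → X = T

theorem isTope_iff (T : E → SignType) :
    M.IsTope T ↔ T ∈ M.covectors ∧ ∀ e, T e = 0 → ∀ X ∈ M.covectors, X e = 0 := by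
  refine and_congr_right fun hT => ⟨fun h e he X hX => ?_, fun h X hX hle => ?_⟩
  · have h1 := h (signComp T X) (M.comp_mem T hT X hX) fun f hf => by simp [signComp, hf]
    have h2 := congrFun h1 e
    simpa [signComp, he] using h2
  · funext e
    by_cases he : T e = 0
    · rw [he, h e he X hX]
    · exact (hle e he).symm

/-- The set of topes `𝒯(M)`. -/
def Tope : Type _ := {T : E → SignType // M.IsTope T}

instance [Finite E] : Finite M.Tope := inferInstanceAs (Finite {T : E → SignType // M.IsTope T})

/-- The tope space `R[𝒯(M)]`. -/
abbrev TopeSpace (R : Type*) [Semiring R] : Type _ := M.Tope →₀ R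

open scoped Classical in
/-- The Heaviside function `h_e` as an element of the Varchenko--Gelfand ring. The ring
`ℤ[𝒯(M)]^*` is identified with the ring of functions `𝒯(M) → ℤ` with pointwise operations. -/
def heaviside (e : E) : M.Tope → ℤ :=
  fun T => if T.1 e = 1 then 1 else 0

/-- The `k`-th piece `𝒫^k(M)` of the degree filtration: `0` and all functions that are represented
by a polynomial of degree at most `k` in the Heaviside functions (so `𝒫^{-1}(M) = 0`). -/
def degreeFiltration (k : ℤ) : Set (M.Tope → ℤ) :=
  {f | f = 0 ∨ ∃ q : MvPolynomial E ℤ, (q.totalDegree : ℤ) ≤ k ∧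
    MvPolynomial.aeval M.heaviside q = f}

/-- The `p`-th piece `𝒫_p(M)` of the dual degree filtration: the annihilator of `𝒫^{p-1}(M)` under
the pairing `(f, γ) ↦ f(γ)`. -/
def dualDegree (p : ℕ) : Submodule ℤ (M.TopeSpace ℤ) :=
  ⨅ f ∈ M.degreeFiltration ((p : ℤ) - 1), LinearMap.ker (Finsupp.linearCombination ℤ f)

/-- Reduction modulo 2 of the `ℤ`-tope space. -/
def mod2 : M.TopeSpace ℤ →+ M.TopeSpace (ZMod 2) :=
  Finsupp.mapRange.addMonoidHom (Int.castAddHom (ZMod 2))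

/-- The mod 2 reduction of `𝒫_p(M)`, i.e. its image in the `ℤ/2`-tope space. -/
def dualDegreeMod2 (p : ℕ) :
    Submodule (ZMod 2) (M.TopeSpace (ZMod 2)) :=
  AddSubgroup.toZModSubmodule 2 ((M.dualDegree p).toAddSubgroup.map M.mod2)

variable {M}

theorem IsTope.neg {T : E → SignType} (hT : M.IsTope T) : M.IsTope (-T) := by
  rw [isTope_iff] at hT ⊢
  exact ⟨M.neg_mem T hT.1, fun e he => hT.2 e (by simpa using he)⟩

theorem IsTope.comp {L T : E → SignType} (hL : L ∈ M.covectors) (hT : M.IsTope T) :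
    M.IsTope (signComp L T) := by
  rw [isTope_iff] at hT ⊢
  refine ⟨M.comp_mem L hL T hT.1, fun e he => ?_⟩
  by_cases hLe : L e = 0
  · exact hT.2 e (by simpa [signComp, hLe] using he)
  · simp [signComp, hLe] at he

theorem signLE_comp (L T : E → SignType) : SignLE L (signComp L T) := by
  intro e he; simp [signComp, he]

/-! ### The Salvetti complex and its mod 2 cellular chains -/

variable (M)

/-- A pair `L ≤ T` of a covector and a tope. Such a pair indexes an element `w(L, T)` of the
Salvetti poset and a cell `Z(L, T)` of the Salvetti complex. -/
@[ext]
structure SalvettiCell where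
  covector : E → SignType
  tope : E → SignType
  covector_mem : covector ∈ M.covectors
  isTope : M.IsTope tope
  le : SignLE covector tope

instance [Finite E] : Finite M.SalvettiCell :=
  Finite.of_injective (fun c : M.SalvettiCell => (c.covector, c.tope)) fun c c' h => by
    simp only [Prod.mk.injEq] at h
    exact SalvettiCell.ext h.1 h.2

/-- The Salvetti poset: `w(L, T) ≤ w(L', T')` iff `L' ≤ L` and `T = L ∘ T'`. It is the face poset
of the regular CW complex `Sal_M`: the faces of the cell `Z(L', T')` are the cells
`Z(L, L ∘ T')` with `L ≥ L'`. -/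
instance : PartialOrder M.SalvettiCell where
  le c c' := SignLE c'.covector c.covector ∧ c.tope = signComp c.covector c'.tope
  le_refl c := ⟨fun _ _ => rfl, by
    funext e
    by_cases h : c.covector e = 0
    · simp [signComp, h]
    · simp [signComp, c.le e h]⟩
  le_trans a b c hab hbc := by
    refine ⟨fun e he => ?_, ?_⟩
    · have h1 := hbc.1 e he
      rw [h1]
      exact hab.1 e (h1 ▸ he)
    · rw [hab.2, hbc.2]
      funext e
      by_cases ha : a.covector e = 0
      · have hb : b.covector e = 0 := by
          by_contra hb
          exact hb ((hab.1 e hb).trans ha)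
        simp [signComp, ha, hb]
      · simp [signComp, ha]
  le_antisymm a b hab hba := by
    have hc : a.covector = b.covector := by
      funext e
      by_cases ha : a.covector e = 0
      · by_contra hb
        rw [ha] at hb
        exact hb ((hab.1 e (Ne.symm hb)).trans ha).symm
      · exact hba.1 e ha
    refine SalvettiCell.ext hc ?_
    rw [hab.2]
    funext e
    by_cases ha : a.covector e = 0
    · simp [signComp, ha]
    · have hb : b.covector e ≠ 0 := hc ▸ ha
      simp only [signComp, ha, if_false]
      rw [hc, b.le e hb]

variable {M}

/-- The cell `Z(L, T) = Z(L, L ∘ T)` for an arbitrary covector `L` and tope `T`. -/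
def cell {L T : E → SignType} (hL : L ∈ M.covectors) (hT : M.IsTope T) : M.SalvettiCell where
  covector := L
  tope := signComp L T
  covector_mem := hL
  isTope := hT.comp hL
  le := signLE_comp L T

/-- The vertex `Z(T, T)` corresponding to a tope `T`. -/
def vertex (T : M.Tope) : M.SalvettiCell where
  covector := T.1
  tope := T.1
  covector_mem := T.2.1
  isTope := T.2
  le := fun _ _ => rfl

/-- The conjugate cell `Z(L, -T)` of `Z(L, T)`. -/
def SalvettiCell.conj (c : M.SalvettiCell) : M.SalvettiCell := cell c.covector_mem c.isTope.neg

variable (M)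

/-- The space `⨁ᵢ Cᵢ(Sal_M; ℤ/2)` of all mod 2 cellular chains of the Salvetti complex. -/
abbrev SalvettiChain : Type _ := M.SalvettiCell →₀ ZMod 2

/-- The map `i_*` on chains induced by the inclusion of the fixed locus, `T ↦ Z(T, T)`. -/
def fixedInclusion : M.TopeSpace (ZMod 2) →ₗ[ZMod 2] M.SalvettiChain :=
  Finsupp.lmapDomain (ZMod 2) (ZMod 2) vertex

/-- The action of the conjugation on mod 2 chains. -/
def conjChain : M.SalvettiChain →ₗ[ZMod 2] M.SalvettiChain :=
  Finsupp.lmapDomain (ZMod 2) (ZMod 2) SalvettiCell.conj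

variable [Finite E]

/-- The dimension of the cell `Z(L, T)`, i.e. `dim L`. -/
def SalvettiCell.dim {M : OrientedMatroid E} (c : M.SalvettiCell) : ℕ := M.covectorDim c.covector

/-- The subspace `Cᵢ(Sal_M; ℤ/2)` of `i`-dimensional chains. -/
def chains (i : ℕ) : Submodule (ZMod 2) M.SalvettiChain :=
  Finsupp.supported (ZMod 2) (ZMod 2) {c : M.SalvettiCell | c.dim = i}

open scoped Classical in
/-- The mod 2 cellular boundary of the regular CW complex `Sal_M`: the boundary of a cell is the
sum of its faces of dimension one less. -/
def boundary : M.SalvettiChain →ₗ[ZMod 2] M.SalvettiChain :=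
  letI := Fintype.ofFinite M.SalvettiCell
  Finsupp.linearCombination (ZMod 2) fun c : M.SalvettiCell =>
    ∑ c' : M.SalvettiCell with c' ≤ c ∧ c'.dim + 1 = c.dim, Finsupp.single c' 1

/-! ### The Kalinin filtration -/

/-- The chains `β₁, …, β_p` certify that `γ` is in the `p`-th piece of the Kalinin filtration:
`βᵢ` is an `i`-chain, `∂β₁ = i_*γ`, and `∂βᵢ₊₁ = βᵢ + conj βᵢ` for `1 ≤ i < p`.
The values `βᵢ` for `i = 0` or `i > p` are irrelevant. -/
structure IsKalininWitness (γ : M.TopeSpace (ZMod 2)) (p : ℕ) (β : ℕ → M.SalvettiChain) :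
    Prop where
  mem_chains : ∀ i, 1 ≤ i → i ≤ p → β i ∈ M.chains i
  boundary_one : 1 ≤ p → M.boundary (β 1) = M.fixedInclusion γ
  boundary_succ : ∀ i, 1 ≤ i → i < p → M.boundary (β (i + 1)) = β i + M.conjChain (β i)

/-- The `p`-th piece `𝒦_p(M)` of the Kalinin filtration of the `ℤ/2`-tope space. -/
def kalinin (p : ℕ) : Submodule (ZMod 2) (M.TopeSpace (ZMod 2)) where
  carrier := {γ | ∃ β, M.IsKalininWitness γ p β}
  zero_mem' := ⟨0, fun i _ _ => (M.chains i).zero_mem, fun _ => by simp, fun i _ _ => by simp⟩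
  add_mem' := by
    rintro γ γ' ⟨β, h⟩ ⟨β', h'⟩
    refine ⟨β + β', fun i h1 h2 => (M.chains i).add_mem (h.1 i h1 h2) (h'.1 i h1 h2),
      fun h1 => ?_, fun i h1 h2 => ?_⟩
    · simp only [Pi.add_apply, map_add, h.2 h1, h'.2 h1]
    · simp only [Pi.add_apply, map_add, h.3 i h1 h2, h'.3 i h1 h2]
      abel
  smul_mem' := by
    rintro a γ ⟨β, h⟩
    refine ⟨a • β, fun i h1 h2 => (M.chains i).smul_mem a (h.1 i h1 h2),
      fun h1 => ?_, fun i h1 h2 => ?_⟩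
    · simp only [Pi.smul_apply, map_smul, h.2 h1]
    · simp only [Pi.smul_apply, map_smul, h.3 i h1 h2, smul_add]

/-! ### Prefix chains -/

/-- A complete flag of flats `∅ = F₀ < F₁ < ⋯ < F_d = E`, where `d` is the rank of `M`. -/
structure CompleteFlag where
  flat : Fin (M.rank + 1) → Set E
  isFlat : ∀ i, M.underlyingMatroid.IsFlat (flat i)
  flat_zero : flat 0 = ∅
  flat_last : flat (Fin.last M.rank) = Set.univ
  strictMono : StrictMono flat

variable {M}

/-- The set `𝒯_F`: topes `T` such that `T \ Fᵢ` is a covector for all `Fᵢ` in the flag. -/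
def CompleteFlag.IsFlagTope (F : M.CompleteFlag) (T : E → SignType) : Prop :=
  M.IsTope T ∧ ∀ i, signDelete T (F.flat i) ∈ M.covectors

/-- `d_{i+1}`, the indicator vector of `F_{i+1} \ F_i`, for `i = 0, …, d - 1`. -/
def CompleteFlag.step (F : M.CompleteFlag) (i : Fin M.rank) : E → ZMod 2 :=
  Set.indicator (F.flat i.succ \ F.flat i.castSucc) 1

/-- The vector `v + ∑_{i ∈ S} d_{i+1}`. -/
def CompleteFlag.point (F : M.CompleteFlag) (v : E → ZMod 2) (S : Finset (Fin M.rank)) :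
    E → ZMod 2 := v + ∑ i ∈ S, F.step i

theorem CompleteFlag.isFlagTope_add_step (F : M.CompleteFlag) {v : E → ZMod 2}
    (hv : F.IsFlagTope (signVec v)) (i : Fin M.rank) :
    F.IsFlagTope (signVec (v + F.step i)) := by
  have hsub : F.flat i.castSucc ⊆ F.flat i.succ :=
    (F.strictMono (Fin.castSucc_lt_succ (i := i))).le
  have hz : ∀ a : ZMod 2, a = 0 ∨ a = 1 := by decide
  have hT : M.IsTope (signVec (v + F.step i)) := by
    have hcov : signVec (v + F.step i) = signComp (signDelete (signVec v) (F.flat i.succ))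
        (signComp (-signDelete (signVec v) (F.flat i.castSucc)) (signVec v)) := by
      funext e
      by_cases h1 : e ∈ F.flat i.succ <;> by_cases h2 : e ∈ F.flat i.castSucc <;>
        rcases hz (v e) with h3 | h3 <;>
        simp [signVec, signComp, signDelete, CompleteFlag.step, h1, h2, h3] <;>
        first | (exact absurd (hsub h2) h1) | decide
    rw [hcov]
    exact (hv.1.comp (M.neg_mem _ (hv.2 _))).comp (hv.2 _)
  refine ⟨hT, fun j => ?_⟩
  rcases le_or_gt i.succ j with hj | hj
  · have hsub' : F.flat i.succ ⊆ F.flat j := F.strictMono.monotone hj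
    have : signDelete (signVec (v + F.step i)) (F.flat j) =
        signDelete (signVec v) (F.flat j) := by
      funext e
      by_cases h1 : e ∈ F.flat j
      · simp [signDelete, h1]
      · have h2 : e ∉ F.flat i.succ := fun h => h1 (hsub' h)
        simp [signDelete, signVec, CompleteFlag.step, h1, h2]
    rw [this]
    exact hv.2 j
  · have hj' : j ≤ i.castSucc := by
      rw [Fin.le_def]; rw [Fin.lt_def] at hj; simp at hj ⊢; omega
    have hsub' : F.flat j ⊆ F.flat i.castSucc := F.strictMono.monotone hj'
    have : signDelete (signVec (v + F.step i)) (F.flat j) =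
        signComp (signDelete (signVec v) (F.flat i.succ))
          (signComp (-signDelete (signVec v) (F.flat i.castSucc))
            (signDelete (signVec v) (F.flat j))) := by
      funext e
      by_cases h0 : e ∈ F.flat j
      · simp [signDelete, signComp, h0, hsub' h0, hsub (hsub' h0)]
      · by_cases h1 : e ∈ F.flat i.succ <;> by_cases h2 : e ∈ F.flat i.castSucc <;>
          rcases hz (v e) with h3 | h3 <;>
          simp [signVec, signComp, signDelete, CompleteFlag.step, h0, h1, h2, h3] <;>
          first | (exact absurd (hsub h2) h1) | decide
    rw [this]
    exact M.comp_mem _ (hv.2 _) _ (M.comp_mem _ (M.neg_mem _ (hv.2 _)) _ (hv.2 _))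

theorem CompleteFlag.isFlagTope_point (F : M.CompleteFlag) {v : E → ZMod 2}
    (hv : F.IsFlagTope (signVec v)) (S : Finset (Fin M.rank)) :
    F.IsFlagTope (signVec (F.point v S)) := by
  classical
  induction S using Finset.induction_on with
  | empty => simpa [CompleteFlag.point] using hv
  | insert i S hi ih =>
    have : F.point v (insert i S) = F.point v S + F.step i := by
      simp only [CompleteFlag.point, Finset.sum_insert hi]
      abel
    rw [this]
    exact F.isFlagTope_add_step ih i

/-- The subsets of `{0, …, p - 1}`. As `d_1, …, d_p` are linearly independent (nonzero, with disjoint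
supports), `S ↦ v + ∑_{i ∈ S} d_{i+1}` is a bijection from these subsets onto the affine subspace
`U_{F,v,p} = v + ⟨d_1, …, d_p⟩`, and the weight of the point indexed by `S` with respect to
the basis `d_1, …, d_p` and the origin `v` is the cardinality of `S`. -/
def prefixSubsets (d p : ℕ) : Finset (Finset (Fin d)) :=
  (Finset.univ.filter fun i : Fin d => (i : ℕ) < p).powerset

/-- The `p`-th prefix chain `γ_{F,v,p} = ∑_{u ∈ U_{F,v,p}} (-1)^{w(u)} T_u ∈ ℤ[𝒯(M)]`. -/
def CompleteFlag.prefixChain (F : M.CompleteFlag) {v : E → ZMod 2}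
    (hv : F.IsFlagTope (signVec v)) (p : ℕ) : M.TopeSpace ℤ :=
  ∑ S ∈ prefixSubsets M.rank p,
    Finsupp.single (⟨signVec (F.point v S), (F.isFlagTope_point hv S).1⟩ : M.Tope)
      ((-1 : ℤ) ^ S.card)

/-- The chain `∑_{u ∈ U_{F,v,q}} Z(T_v \ F_{q+1}, T_u)` for `q = 0, …, d - 1`. -/
def CompleteFlag.topChain (F : M.CompleteFlag) {v : E → ZMod 2}
    (hv : F.IsFlagTope (signVec v)) (q : Fin M.rank) : M.SalvettiChain :=
  ∑ S ∈ prefixSubsets M.rank q,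
    Finsupp.single (cell (hv.2 q.succ) (F.isFlagTope_point hv S).1) 1

end OrientedMatroid

end

/-! Both parts rest on one construction. Take a descending chain of covectors `X 0 > ⋯ > X p` from a
tope whose zero sets `F_0 < ⋯ < F_p` form a saturated chain of flats. Reversing the signs of `X 0`
on any choice `S` of the differences `F_{i+1} \ F_i` gives again a tope `flip X S`, and `flipSum X
p` is the alternating sum of these `2 ^ p` topes. For `X i = T_v \ F_i` this is the prefix chain of
a flag.

Mod 2, a flip sum has an explicit Kalinin witness: `halfChain i` sums the cells `Z(T \ F_i, T)` over
the topes `T = flip X S` with `i - 1 ∉ S`. Conjugation toggles all steps below `i`, step `i - 1`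
among them, so `halfChain i` plus its conjugate is the sum `fullChain i` over all `S`
(`halfChain_add_conjChain`). In the boundary of `halfChain (i + 1)`, the faces with zero set `F_i`
add up to `fullChain i`. Any other face of dimension `i` misses some difference `F_{j+1} \ F_j` with
`j < i`, does not see whether step `j` is flipped, and so cancels in pairs (`boundary_halfChain`).
This proves (a), since `halfChain p` is the prescribed top chain.

For (b), flip sums generate the integral annihilator of the polynomials of degree below `p`
(`lowAnnihilator_le_flipSpan`). The proof is by deletion and contraction of a non-loop `e`: cover
chains lift from the deletion of the parallel class of `e` (`exists_isCoverChain_of_deletion`), and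
what the deletion kills comes from the contraction in one degree less (`exists_eq_compSub`).
Reducing an integral combination of flip sums mod 2 then gives an element of the Kalinin piece. -/

namespace OrientedMatroid

/-! ### Reversing signs along a descending chain of covectors -/

section Flips

variable {E : Type*}

open scoped Classical in
/-- The sign vector obtained from `X 0` by reversing the signs on the differences of supports
`supp (X i) \ supp (X (i + 1))` for `i ∈ S`. -/
def flip (X : ℕ → E → SignType) (S : Finset ℕ) : E → SignType :=
  fun e => if ∃ i ∈ S, X i e ≠ 0 ∧ X (i + 1) e = 0 then -X 0 e else X 0 e

/-- The restriction of `flip X S` to the support of `X i`. -/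
noncomputable def flipFace (X : ℕ → E → SignType) (i : ℕ) (S : Finset ℕ) : E → SignType :=
  signDelete (flip X S) {e | X i e = 0}

/-- The alternating sum of all sign vectors `flip X S` with `S ⊆ {0, …, p - 1}`. -/
noncomputable def flipSum (X : ℕ → E → SignType) (p : ℕ) : (E → SignType) →₀ ℤ :=
  ∑ S ∈ (Finset.range p).powerset, Finsupp.single (flip X S) ((-1) ^ S.card)

/-- A chain `X 0 > X 1 > ⋯ > X p` of covectors that starts at a tope and whose zero sets form
a saturated chain of flats; it is continued by the constant value `X p`. -/
structure IsCoverChain (M : OrientedMatroid E) (p : ℕ) (X : ℕ → E → SignType) : Prop where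
  isTope : M.IsTope (X 0)
  mem : ∀ i, X i ∈ M.covectors
  le : ∀ i, SignLE (X (i + 1)) (X i)
  lt : ∀ i < p, ∃ e, X i e ≠ 0 ∧ X (i + 1) e = 0
  cover : ∀ i < p, ∀ e, X i e ≠ 0 → X (i + 1) e = 0 →
    ∀ f, X (i + 1) f = 0 → M.InClosure (insert e {g | X i g = 0}) f
  tail : ∀ i, p ≤ i → X i = X p

/-- A descending sequence of sign vectors. -/
def SignAntitone (X : ℕ → E → SignType) : Prop := ∀ i, SignLE (X (i + 1)) (X i)

variable {X : ℕ → E → SignType}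

theorem SignAntitone.signLE (hX : SignAntitone X) {i j : ℕ} (hij : i ≤ j) :
    SignLE (X j) (X i) := by
  induction j, hij using Nat.le_induction with
  | base => exact fun _ _ => rfl
  | succ j _ ih =>
    intro e he
    have h := hX j e he
    rw [h]
    exact ih e (h ▸ he)

theorem SignAntitone.eq_zero (hX : SignAntitone X) {i j : ℕ} (hij : i ≤ j) {e : E}
    (h : X i e = 0) : X j e = 0 := by
  by_contra hj
  exact hj ((hX.signLE hij e hj).trans h)

/-- Once an entry has become zero it stays zero, so the differences of successive supports are
disjoint and each element belongs to at most one step. -/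
theorem SignAntitone.drop_unique (hX : SignAntitone X) {i j : ℕ} {e : E}
    (hi : X i e ≠ 0) (hi' : X (i + 1) e = 0) (hj : X j e ≠ 0) (hj' : X (j + 1) e = 0) :
    i = j := by
  rcases lt_trichotomy i j with h | h | h
  · exact absurd (hX.eq_zero h hi') hj
  · exact h
  · exact absurd (hX.eq_zero h hj') hi

theorem exists_drop {n : ℕ} {e : E}
    (h0 : X 0 e ≠ 0) (hn : X n e = 0) : ∃ i < n, X i e ≠ 0 ∧ X (i + 1) e = 0 := by
  induction n with
  | zero => exact absurd hn h0
  | succ n ih =>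
    by_cases h : X n e = 0
    · obtain ⟨i, hi, h⟩ := ih h
      exact ⟨i, by omega, h⟩
    · exact ⟨n, by omega, h, hn⟩

theorem SignAntitone.flip_of_drop (hX : SignAntitone X) {i : ℕ} {e : E} (S : Finset ℕ)
    (hi : X i e ≠ 0) (hi' : X (i + 1) e = 0) :
    flip X S e = if i ∈ S then -X 0 e else X 0 e := by
  unfold flip
  congr 1
  refine propext ⟨?_, fun h => ⟨i, h, hi, hi'⟩⟩
  rintro ⟨j, hj, h, h'⟩
  rwa [hX.drop_unique hi hi' h h']

theorem flip_congr {S S' : Finset ℕ} {e : E}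
    (h : ∀ i, X i e ≠ 0 → X (i + 1) e = 0 → (i ∈ S ↔ i ∈ S')) : flip X S e = flip X S' e := by
  unfold flip
  congr 1
  refine propext ⟨?_, ?_⟩
  · rintro ⟨i, hi, h1, h2⟩
    exact ⟨i, (h i h1 h2).1 hi, h1, h2⟩
  · rintro ⟨i, hi, h1, h2⟩
    exact ⟨i, (h i h1 h2).2 hi, h1, h2⟩

theorem flip_eq_zero_iff {S : Finset ℕ} {e : E} : flip X S e = 0 ↔ X 0 e = 0 := by
  unfold flip
  split_ifs <;> simp

theorem flip_empty : flip X ∅ = X 0 := by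
  funext e
  simp [flip]

theorem flipFace_zero : flipFace X 0 = flip X := by
  funext S e
  by_cases h : X 0 e = 0
  · simp [flipFace, signDelete, h, flip_eq_zero_iff.2 h]
  · simp [flipFace, signDelete, h]

theorem SignAntitone.flipFace_eq_zero_iff (hX : SignAntitone X) {i : ℕ} {S : Finset ℕ} {e : E} :
    flipFace X i S e = 0 ↔ X i e = 0 := by
  by_cases h : X i e = 0
  · simp [flipFace, signDelete, h]
  · simp only [flipFace, signDelete, Set.mem_ofPred_eq, h, if_false, flip_eq_zero_iff, iff_false]
    exact fun h0 => h (hX.eq_zero (Nat.zero_le i) h0)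

theorem flipFace_of_ne_zero {i : ℕ} {S : Finset ℕ} {e : E} (h : X i e ≠ 0) :
    flipFace X i S e = flip X S e := by
  simp [flipFace, signDelete, h]

theorem flipFace_of_eq_zero {i : ℕ} {S : Finset ℕ} {e : E} (h : X i e = 0) :
    flipFace X i S e = 0 := by
  simp [flipFace, signDelete, h]

theorem SignAntitone.flipFace_congr (hX : SignAntitone X) {i : ℕ} {S S' : Finset ℕ}
    (h : ∀ j, i ≤ j → (j ∈ S ↔ j ∈ S')) : flipFace X i S = flipFace X i S' := by
  funext e
  by_cases he : X i e = 0
  · rw [flipFace_of_eq_zero he, flipFace_of_eq_zero he]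
  · rw [flipFace_of_ne_zero he, flipFace_of_ne_zero he]
    refine flip_congr fun j _ h2 => h j ?_
    by_contra hij
    exact he (hX.eq_zero (by omega) h2)

theorem SignAntitone.flip_insert (hX : SignAntitone X) {i : ℕ} {S : Finset ℕ} (hi : i ∉ S)
    (e : E) :
    flip X (insert i S) e = if X i e ≠ 0 ∧ X (i + 1) e = 0 then -flip X S e else flip X S e := by
  split_ifs with h
  · rw [hX.flip_of_drop _ h.1 h.2, hX.flip_of_drop _ h.1 h.2]
    simp [hi]
  · refine flip_congr fun j h1 h2 => ?_
    have : j ≠ i := by rintro rfl; exact h ⟨h1, h2⟩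
    simp [this]

/-- Induct on the set of flipped steps. A step `k < i` is invisible on the support of `X i`. For `k
≥ i`, flipping step `k` is the composition of the faces at `k + 1`, the negative of the one at `k`,
and the one at `i`: the first fixes the signs outside `F_{k+1}`, the second reverses those on
`F_{k+1} \ F_k`, the third restores the rest. -/
theorem SignAntitone.flipFace_mem {M : OrientedMatroid E} (hX : SignAntitone X)
    (hM : ∀ i, X i ∈ M.covectors) (S : Finset ℕ) (i : ℕ) : flipFace X i S ∈ M.covectors := by
  classical
  induction S using Finset.induction_on generalizing i with
  | empty =>
    convert hM i using 1
    funext e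
    by_cases h : X i e = 0
    · rw [flipFace_of_eq_zero h, h]
    · rw [flipFace_of_ne_zero h, flip_empty, hX.signLE (Nat.zero_le i) e h]
  | insert k S hk ih =>
    rcases le_or_gt (k + 1) i with h | h
    · rw [hX.flipFace_congr (S' := S)]
      · exact ih i
      · intro j hj
        have : j ≠ k := by omega
        simp [this]
    · convert M.comp_mem _ (ih (k + 1)) _ (M.comp_mem _ (M.neg_mem _ (ih k)) _ (ih i)) using 1
      funext e
      have h0 : ∀ j, flipFace X j S e = 0 ↔ X j e = 0 := fun j => hX.flipFace_eq_zero_iff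
      have hki : X i e = 0 → X k e = 0 := hX.eq_zero (by omega)
      have hkk : X k e = 0 → X (k + 1) e = 0 := hX.eq_zero (by omega)
      by_cases h1 : X i e = 0
      · simp [signComp, flipFace_of_eq_zero, h1, hki h1, hkk (hki h1)]
      · rw [flipFace_of_ne_zero h1, hX.flip_insert hk]
        by_cases h2 : X k e = 0
        · simp [signComp, flipFace_of_eq_zero, flipFace_of_ne_zero, h1, h2, hkk h2]
        · by_cases h3 : X (k + 1) e = 0
          · have h4 : flip X S e ≠ 0 := fun h =>
              h2 (hX.eq_zero (Nat.zero_le k) (flip_eq_zero_iff.1 h))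
            simp only [signComp, Pi.neg_apply, h0, h3, if_true]
            rw [flipFace_of_ne_zero h2]
            simp [h2, h4]
          · simp only [signComp, h0, h3, if_false]
            rw [flipFace_of_ne_zero h3]
            simp

theorem SignAntitone.isTope_flip {M : OrientedMatroid E} (hX : SignAntitone X)
    (hM : ∀ i, X i ∈ M.covectors) (h0 : M.IsTope (X 0)) (S : Finset ℕ) :
    M.IsTope (flip X S) := by
  rw [isTope_iff] at h0 ⊢
  refine ⟨?_, fun e he => h0.2 e (flip_eq_zero_iff.1 he)⟩
  rw [← flipFace_zero]
  exact hX.flipFace_mem hM S 0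

end Flips

/-! ### Flip sums are annihilated by polynomials of low degree -/

section PosEval

variable {E : Type*}

open scoped Classical in
/-- Evaluation of the product of the Heaviside functions `h_e`, `e ∈ S`. -/
noncomputable def posEval (S : Finset E) : ((E → SignType) →₀ ℤ) →ₗ[ℤ] ℤ :=
  Finsupp.linearCombination ℤ fun T => if ∀ e ∈ S, T e = 1 then 1 else 0

/-- The formal sums of topes annihilated by all products of fewer than `p` Heaviside functions. -/
noncomputable def lowAnnihilator (M : OrientedMatroid E) (p : ℕ) : Submodule ℤ ((E → SignType) →₀ ℤ) where
  carrier := {γ | (∀ T, γ T ≠ 0 → M.IsTope T) ∧ ∀ S : Finset E, S.card < p → posEval S γ = 0}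
  zero_mem' := by simp
  add_mem' := by
    rintro a b ⟨ha, ha'⟩ ⟨hb, hb'⟩
    refine ⟨fun T hT => ?_, fun S hS => by simp [ha' S hS, hb' S hS]⟩
    by_cases h : a T = 0
    · exact hb T fun h' => hT (by simp [h, h'])
    · exact ha T h
  smul_mem' := by
    rintro c a ⟨ha, ha'⟩
    exact ⟨fun T hT => ha T fun h => hT (by simp [h]), fun S hS => by simp [ha' S hS]⟩

/-- The span of the alternating flip sums of cover chains of length `p`. -/
noncomputable def flipSpan (M : OrientedMatroid E) (p : ℕ) : Submodule ℤ ((E → SignType) →₀ ℤ) :=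
  Submodule.span ℤ {γ | ∃ X, M.IsCoverChain p X ∧ flipSum X p = γ}

theorem posEval_single (S : Finset E) (T : E → SignType) (a : ℤ) [Decidable (∀ e ∈ S, T e = 1)] :
    posEval S (Finsupp.single T a) = if ∀ e ∈ S, T e = 1 then a else 0 := by
  simp [posEval]

/-- Fewer than `p` elements cannot meet all `p` disjoint steps. Flipping a step that is missed does
not change the product of Heaviside functions but changes the sign of the coefficient, so the terms
cancel in pairs. -/
theorem posEval_flipSum {X : ℕ → E → SignType} (hX : SignAntitone X) {p : ℕ} {S : Finset E}
    (hS : S.card < p) : posEval S (flipSum X p) = 0 := by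
  classical
  obtain ⟨i, hi, hiS⟩ : ∃ i < p, ∀ e ∈ S, ¬ (X i e ≠ 0 ∧ X (i + 1) e = 0) := by
    by_contra! hcon
    have : Nonempty E := ⟨(hcon 0 (by omega)).choose⟩
    choose! f hf using hcon
    have : (Finset.range p).card ≤ S.card := by
      refine Finset.card_le_card_of_injOn f (fun i hi => (hf i (by simpa using hi)).1) ?_
      intro i hi j hj hij
      obtain ⟨-, h1, h2⟩ := hf i (by simpa using hi)
      obtain ⟨-, h3, h4⟩ := hf j (by simpa using hj)
      rw [← hij] at h3 h4
      exact hX.drop_unique h1 h2 h3 h4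
    rw [Finset.card_range] at this
    omega
  have hr : Finset.range p = insert i ((Finset.range p).erase i) :=
    (Finset.insert_erase (by simpa using hi)).symm
  rw [flipSum, map_sum, hr, Finset.sum_powerset_insert (Finset.notMem_erase _ _),
    ← Finset.sum_add_distrib]
  refine Finset.sum_eq_zero fun U hU => ?_
  have hiU : i ∉ U := fun h => Finset.notMem_erase i _ (Finset.mem_powerset.1 hU h)
  have hiff : (∀ e ∈ S, flip X (insert i U) e = 1) ↔ ∀ e ∈ S, flip X U e = 1 := by
    refine forall₂_congr fun e he => ?_
    rw [hX.flip_insert hiU, if_neg (hiS e he)]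
  rw [posEval_single, posEval_single, Finset.card_insert_of_notMem hiU]
  simp only [hiff]
  split_ifs
  · ring
  · simp

theorem IsCoverChain.flipSum_mem {M : OrientedMatroid E} {p : ℕ} {X : ℕ → E → SignType}
    (hX : M.IsCoverChain p X) : flipSum X p ∈ M.lowAnnihilator p := by
  refine ⟨fun T hT => ?_, fun S hS => posEval_flipSum hX.le hS⟩
  by_contra hcon
  refine hT ?_
  rw [flipSum, Finsupp.finsetSum_apply]
  refine Finset.sum_eq_zero fun S _ => Finsupp.single_eq_of_ne ?_
  rintro rfl
  exact hcon (SignAntitone.isTope_flip hX.le hX.mem hX.isTope S)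

theorem flipSpan_le (M : OrientedMatroid E) (p : ℕ) : M.flipSpan p ≤ M.lowAnnihilator p := by
  refine Submodule.span_le.2 ?_
  rintro _ ⟨X, hX, rfl⟩
  exact hX.flipSum_mem

end PosEval

/-! ### Deletion and contraction on a fixed ground set -/

section Minors

variable {E : Type*}

/-- The deletion of `A`, with the elements of `A` kept as loops. -/
noncomputable def deletion (M : OrientedMatroid E) (A : Set E) : OrientedMatroid E where
  covectors := {Y | ∃ X ∈ M.covectors, signDelete X A = Y}
  zero_mem := ⟨0, M.zero_mem, by funext e; simp [signDelete]⟩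
  neg_mem := by
    rintro _ ⟨X, hX, rfl⟩
    refine ⟨-X, M.neg_mem X hX, ?_⟩
    funext e
    by_cases h : e ∈ A <;> simp [signDelete, h]
  comp_mem := by
    rintro _ ⟨X, hX, rfl⟩ _ ⟨Y, hY, rfl⟩
    refine ⟨_, M.comp_mem X hX Y hY, ?_⟩
    funext e
    by_cases h : e ∈ A <;> simp [signDelete, signComp, h]
  elimination := by
    rintro _ ⟨X, hX, rfl⟩ _ ⟨Y, hY, rfl⟩ e he hXY
    have heA : e ∉ A := fun h => he (by simp [signDelete, h])
    simp only [signDelete, heA, if_false] at he hXY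
    obtain ⟨Z, hZ, hZe, hZ'⟩ := M.elimination X hX Y hY e he hXY
    refine ⟨_, ⟨Z, hZ, rfl⟩, by simp [signDelete, heA, hZe], fun f hf => ?_⟩
    by_cases h : f ∈ A
    · simp [signDelete, signComp, h]
    · simp only [signDelete, h, if_false, signComp] at hf ⊢
      exact hZ' f hf

/-- The contraction of the closure of `e`, with its elements kept as loops. -/
def contraction (M : OrientedMatroid E) (e : E) : OrientedMatroid E where
  covectors := {X | X ∈ M.covectors ∧ X e = 0}
  zero_mem := ⟨M.zero_mem, rfl⟩
  neg_mem := fun X hX => ⟨M.neg_mem X hX.1, by simp [hX.2]⟩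
  comp_mem := fun X hX Y hY => ⟨M.comp_mem X hX.1 Y hY.1, by simp [signComp, hX.2, hY.2]⟩
  elimination := by
    intro X hX Y hY f hf hXY
    obtain ⟨Z, hZ, hZf, hZ'⟩ := M.elimination X hX.1 Y hY.1 f hf hXY
    refine ⟨Z, ⟨hZ, ?_⟩, hZf, hZ'⟩
    rw [hZ' e (by simp [hX.2])]
    simp [signComp, hX.2, hY.2]

variable {M : OrientedMatroid E}

theorem deletion_inClosure_iff {A B : Set E} {e : E} (he : e ∉ A) :
    (M.deletion A).InClosure B e ↔ M.InClosure (B \ A) e := by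
  constructor
  · intro h X hX h0
    have := h _ ⟨X, hX, rfl⟩ fun a ha => by
      by_cases haA : a ∈ A
      · simp [signDelete, haA]
      · simp [signDelete, haA, h0 a ⟨ha, haA⟩]
    simpa [signDelete, he] using this
  · rintro h _ ⟨X, hX, rfl⟩ h0
    have := h X hX fun a ha => by simpa [signDelete, ha.2] using h0 a ha.1
    simp [signDelete, he, this]

theorem contraction_inClosure_iff {B : Set E} {e f : E} :
    (M.contraction e).InClosure B f ↔ M.InClosure (insert e B) f := by
  constructor
  · exact fun h X hX h0 => h X ⟨hX, h0 e (by simp)⟩ fun a ha => h0 a (by simp [ha])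
  · rintro h X ⟨hX, hXe⟩ h0
    refine h X hX ?_
    rintro a (rfl | ha)
    exacts [hXe, h0 a ha]

/-- Two covectors vanishing on `F` that agree at a point of the closure of `F ∪ {e}`
also agree at `e`. -/
theorem eq_of_inClosure_insert {F : Set E} {e f : E} (h : M.InClosure (insert e F) f)
    {X Y : E → SignType} (hX : X ∈ M.covectors) (hY : Y ∈ M.covectors)
    (hXF : ∀ g ∈ F, X g = 0) (hYF : ∀ g ∈ F, Y g = 0) (hXY : X f = Y f) (hf : X f ≠ 0) :
    X e = Y e := by
  have hne : ∀ Z ∈ M.covectors, (∀ g ∈ F, Z g = 0) → Z f ≠ 0 → Z e ≠ 0 := by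
    intro Z hZ hZF hZf hZe
    refine hZf (h Z hZ ?_)
    rintro a (rfl | ha)
    exacts [hZe, hZF a ha]
  have hXe := hne X hX hXF hf
  have hYe := hne Y hY hYF (hXY ▸ hf)
  by_contra hcon
  -- If the signs at `e` were opposite, eliminating `e` would give a covector vanishing on `F` and
  -- at `e`, but not at `f`, where `X` and `Y` agree.
  obtain ⟨Z, hZ, hZe, hZ'⟩ :=
    M.elimination X hX Y hY e hXe (signType_eq_neg_of_ne hXe hYe hcon)
  refine hne Z hZ (fun g hg => ?_) ?_ hZe
  · rw [hZ' g (by simp [hXF g hg])]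
    simp [signComp, hXF g hg, hYF g hg]
  · have hno : X f ≠ -Y f := by
      rw [← hXY]
      revert hf
      generalize X f = s
      revert s
      decide
    rw [hZ' f (by simp [hno])]
    simp [signComp, hf]

end Minors

/-! ### Flip sums generate the annihilator -/

section Span

variable {E : Type*} {M : OrientedMatroid E}

theorem IsTope.inClosure_empty {T : E → SignType} (hT : M.IsTope T) {f : E} (hf : T f = 0) :
    M.InClosure ∅ f :=
  fun X hX _ => ((isTope_iff M T).1 hT).2 f hf X hX

theorem inClosure_singleton_comm {e f : E} (hf : ¬ M.InClosure ∅ f) (h : M.InClosure {e} f) :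
    M.InClosure {f} e := by
  have := InClosure.exchange (A := ∅) (by simpa using h) hf
  simpa using this

theorem IsTope.signDelete {T : E → SignType} (hT : M.IsTope T) (A : Set E) :
    (M.deletion A).IsTope (signDelete T A) := by
  rw [isTope_iff] at hT ⊢
  refine ⟨⟨T, hT.1, rfl⟩, ?_⟩
  rintro f hf _ ⟨X, hX, rfl⟩
  by_cases h : f ∈ A
  · simp [_root_.signDelete, h]
  · simp only [_root_.signDelete, h, if_false] at hf ⊢
    exact hT.2 f hf X hX

/-- The elements parallel to `e`. -/
def parallelClass (M : OrientedMatroid E) (e : E) : Set E :=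
  {f | ¬ M.InClosure ∅ f ∧ M.InClosure {e} f}

theorem eq_zero_iff_of_mem_parallelClass {e f : E} (hf : f ∈ M.parallelClass e)
    {X : E → SignType} (hX : X ∈ M.covectors) : X f = 0 ↔ X e = 0 := by
  refine ⟨fun h => ?_, fun h => ?_⟩
  · exact inClosure_singleton_comm hf.1 hf.2 X hX (by simpa using h)
  · exact hf.2 X hX (by simpa using h)

theorem eq_of_mem_parallelClass {e f : E} (hf : f ∈ M.parallelClass e)
    {X Y : E → SignType} (hX : X ∈ M.covectors) (hY : Y ∈ M.covectors) (he : X e ≠ 0)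
    (h : X e = Y e) : X f = Y f :=
  eq_of_inClosure_insert (F := ∅) (by simpa using inClosure_singleton_comm hf.1 hf.2) hX hY
    (by simp) (by simp) h he

/-- Only the values on the parallel class `A` have to be chosen. They are forced to be zero as soon
as `e` lies in the closure of the zero set outside `A` (the condition `c`). Before that, all members
of the chain receive the same non-zero values on `A`, taken from a single covector `B`. -/
theorem exists_isCoverChain_of_deletion {e : E} (he : ¬ M.InClosure ∅ e) {p : ℕ}
    {X' : ℕ → E → SignType} (hX' : (M.deletion (M.parallelClass e)).IsCoverChain p X') :
    ∃ X, M.IsCoverChain p X ∧ ∀ i, signDelete (X i) (M.parallelClass e) = X' i := by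
  classical
  set A := M.parallelClass e with hA
  have hanti : SignAntitone X' := hX'.le
  -- The lift is chosen as a function of the sign vector and not of the index, so that the constant
  -- tail of `X'` lifts to a constant tail.
  have hex : ∀ U : E → SignType, ∃ Z, U ∈ (M.deletion A).covectors →
      Z ∈ M.covectors ∧ signDelete Z A = U := by
    intro U
    by_cases hU : U ∈ (M.deletion A).covectors
    · exact ⟨hU.choose, fun _ => hU.choose_spec⟩
    · exact ⟨0, fun h => absurd h hU⟩
  choose L hL using hex
  have hLmem : ∀ i, L (X' i) ∈ M.covectors := fun i => (hL _ (hX'.mem i)).1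
  have hLeq : ∀ i f, f ∉ A → L (X' i) f = X' i f := by
    intro i f hf
    conv_rhs => rw [← (hL _ (hX'.mem i)).2]
    simp [signDelete, hf]
  have hX'A : ∀ i f, f ∈ A → X' i f = 0 := by
    intro i f hf
    rw [← (hL _ (hX'.mem i)).2]
    simp [signDelete, hf]
  set c : (E → SignType) → Prop := fun U => M.InClosure ({g | U g = 0} \ A) e with hc
  have hcmono : ∀ {i j}, i ≤ j → c (X' i) → c (X' j) := fun hij h =>
    h.mono fun g hg => And.intro (hanti.eq_zero hij hg.1) hg.2
  have hloop : ∀ f, f ∉ A → X' 0 f = 0 → M.InClosure ∅ f := by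
    intro f hfA hf
    have := hX'.isTope.inClosure_empty hf
    rw [deletion_inClosure_iff hfA] at this
    simpa using this
  have hc0 : ¬ c (X' 0) := fun h => he (h.trans fun a ha => hloop a ha.2 ha.1)
  obtain ⟨B, hB, hBe, hBle⟩ : ∃ B ∈ M.covectors, B e ≠ 0 ∧
      ∀ i, ¬ c (X' i) → ∀ f, f ∉ A → B f ≠ 0 → B f = X' i f := by
    -- Off `A`, `B` has to lie below every `X' i` for which `c` fails. Hence it is built from the
    -- last such index `k`, with `W` making it non-zero at `e` without enlarging the support off
    -- `A`.
    set k := Nat.findGreatest (fun i => ¬ c (X' i)) p with hk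
    have hck : ¬ c (X' k) :=
      Nat.findGreatest_spec (P := fun i => ¬ c (X' i)) (Nat.zero_le p) hc0
    have hki : ∀ i, ¬ c (X' i) → SignLE (X' k) (X' i) := by
      intro i hi
      rcases le_or_gt i p with h | h
      · exact hanti.signLE (Nat.le_findGreatest h hi)
      · rw [hX'.tail i h.le] at hi ⊢
        exact hanti.signLE (Nat.le_findGreatest le_rfl hi)
    have hck' := hck
    simp only [hc, InClosure, not_forall] at hck'
    obtain ⟨W, hW, hW0, hWe⟩ := hck'
    refine ⟨signComp (L (X' k)) W, M.comp_mem _ (hLmem k) _ hW, ?_, fun i hi f hf hBf => ?_⟩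
    · by_cases h : L (X' k) e = 0 <;> simp [signComp, h, hWe]
    · have h0 : X' k f ≠ 0 := by
        intro h0
        refine hBf ?_
        simp [signComp, hLeq k f hf, h0, hW0 f ⟨h0, hf⟩]
      rw [← hki i hi f h0]
      simp [signComp, hLeq k f hf, h0]
  have hBA : ∀ f ∈ A, B f ≠ 0 := fun f hf h =>
    hBe ((eq_zero_iff_of_mem_parallelClass hf hB).1 h)
  set X : ℕ → E → SignType := fun i =>
    if c (X' i) then L (X' i) else signComp B (L (X' i)) with hX
  have hXmem : ∀ i, X i ∈ M.covectors := by
    intro i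
    simp only [hX]
    split_ifs
    exacts [hLmem i, M.comp_mem _ hB _ (hLmem i)]
  have hXeq : ∀ i f, f ∉ A → X i f = X' i f := by
    intro i f hf
    simp only [hX]
    split_ifs with h
    · exact hLeq i f hf
    · by_cases hBf : B f = 0
      · simp [signComp, hBf, hLeq i f hf]
      · simp only [signComp, hBf, if_false]
        exact hBle i h f hf hBf
  have hXA : ∀ i f, f ∈ A → c (X' i) → X i f = 0 := by
    intro i f hf h
    simp only [hX, if_pos h]
    rw [eq_zero_iff_of_mem_parallelClass hf (hLmem i)]
    exact h _ (hLmem i) fun a ha => (hLeq i a ha.2).trans ha.1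
  have hXB : ∀ i f, f ∈ A → ¬ c (X' i) → X i f = B f := by
    intro i f hf h
    simp [hX, h, signComp, hBA f hf]
  have hXc : ∀ i f, f ∈ A → X i f = 0 → c (X' i) := by
    intro i f hf h
    by_contra hci
    exact hBA f hf ((hXB i f hf hci).symm.trans h)
  have hcov1 : ∀ i < p, ∀ f, f ∉ A → X i f ≠ 0 → X (i + 1) f = 0 → ∀ g, X (i + 1) g = 0 →
      M.InClosure (insert f {g | X i g = 0}) g := by
    intro i hi f hf hf1 hf2 g hg
    rw [hXeq _ f hf] at hf1 hf2
    have key : ∀ h, h ∉ A → X' (i + 1) h = 0 → M.InClosure (insert f {g | X i g = 0}) h := by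
      intro h hh hh'
      have := hX'.cover i hi f hf1 hf2 h hh'
      rw [deletion_inClosure_iff hh] at this
      refine this.mono ?_
      rintro a ⟨rfl | ha, haA⟩
      · simp
      · exact Or.inr ((hXeq i a haA).trans ha)
    by_cases hgA : g ∈ A
    · refine hgA.2.trans ?_
      rintro _ rfl
      exact (hXc _ g hgA hg).trans fun a ha => key a ha.2 ha.1
    · exact key g hgA (by rw [← hXeq _ g hgA, hg])
  refine ⟨X, ⟨?_, hXmem, ?_, ?_, ?_, ?_⟩, ?_⟩
  · rw [isTope_iff]
    refine ⟨hXmem 0, fun f hf Z hZ => ?_⟩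
    by_cases hfA : f ∈ A
    · exact absurd (hXc 0 f hfA hf) hc0
    · exact hloop f hfA (by rw [← hXeq 0 f hfA, hf]) Z hZ (by simp)
  · intro i f hf
    by_cases hfA : f ∈ A
    · have h1 : ¬ c (X' (i + 1)) := fun h => hf (hXA _ f hfA h)
      have h2 : ¬ c (X' i) := fun h => h1 (hcmono (Nat.le_succ i) h)
      rw [hXB _ f hfA h1, hXB _ f hfA h2]
    · rw [hXeq _ f hfA] at hf
      rw [hXeq _ f hfA, hXeq _ f hfA, hX'.le i f hf]
  · intro i hi
    obtain ⟨f, hf1, hf2⟩ := hX'.lt i hi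
    have hfA : f ∉ A := fun h => hf1 (hX'A i f h)
    exact ⟨f, by rwa [hXeq i f hfA], by rwa [hXeq _ f hfA]⟩
  · intro i hi f hf1 hf2 g hg
    by_cases hfA : f ∈ A
    -- Here `A` enters the flat at step `i`. Some `f1` outside `A` enters as well, and exchange
    -- shows that `e`, hence also the parallel element `f`, spans `f1` over the previous flat.
    · obtain ⟨f1, h1, h2⟩ := hX'.lt i hi
      have h1A : f1 ∉ A := fun h => h1 (hX'A i f1 h)
      have hci : ¬ c (X' i) := fun h => hf1 (hXA i f hfA h)
      have hcl := hcov1 i hi f1 h1A (by rwa [hXeq i f1 h1A]) (by rwa [hXeq _ f1 h1A])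
      have hef1 : M.InClosure (insert f1 {g | X i g = 0}) e :=
        (hXc _ f hfA hf2).trans fun a ha => hcl a ((hXeq _ a ha.2).trans ha.1)
      have heF : ¬ M.InClosure {g | X i g = 0} e := by
        refine fun h => hci (h.mono fun a ha => ?_)
        have haA : a ∉ A := fun h => hci (hXc i a h ha)
        exact ⟨(hXeq i a haA).symm.trans ha, haA⟩
      have hfe : M.InClosure {f} e := inClosure_singleton_comm hfA.1 hfA.2
      have hef : M.InClosure (insert f {g | X i g = 0}) e := hfe.mono (by simp)
      refine (hcl g hg).trans ?_
      rintro a (rfl | ha)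
      · refine (hef1.exchange heF).trans ?_
        rintro b (rfl | hb)
        · exact hef
        · exact M.inClosure_of_mem (Or.inr hb)
      · exact M.inClosure_of_mem (Or.inr ha)
    · exact hcov1 i hi f hfA hf1 hf2 g hg
  · intro i hi
    simp only [hX, hX'.tail i hi]
  · intro i
    funext f
    by_cases hf : f ∈ A
    · simp [signDelete, hf, hX'A i f hf]
    · simp [signDelete, hf, hXeq i f hf]

/-- The sequence `X 0 ∘ Y, X 0, X 1, …`. -/
noncomputable def prependComp (Y : E → SignType) (X : ℕ → E → SignType) : ℕ → E → SignType
  | 0 => signComp (X 0) Y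
  | i + 1 => X i

/-- A tope of the contraction vanishes, as a covector of `M`, exactly on the closure of `e`.
Composing with a covector that is non-zero at `e` fills in everything but the loops, so the new
first step is the rank-one flat spanned by `e`. -/
theorem IsCoverChain.prependComp {e : E} {p : ℕ} {X : ℕ → E → SignType}
    (hX : (M.contraction e).IsCoverChain p X) {Y : E → SignType} (hY : Y ∈ M.covectors)
    (hYe : Y e ≠ 0) : M.IsCoverChain (p + 1) (prependComp Y X) := by
  have hcl : ∀ g, X 0 g = 0 → M.InClosure {e} g := by
    intro g hg
    have := hX.isTope.inClosure_empty hg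
    rw [contraction_inClosure_iff] at this
    simpa using this
  refine ⟨?_, ?_, ?_, ?_, ?_, ?_⟩
  · rw [isTope_iff]
    refine ⟨M.comp_mem _ (hX.mem 0).1 _ hY, fun g hg Z hZ => ?_⟩
    by_cases h : X 0 g = 0
    · by_contra hZg
      have hloop : ¬ M.InClosure ∅ g := fun h' => hZg (h' Z hZ (by simp))
      refine hYe (inClosure_singleton_comm hloop (hcl g h) Y hY ?_)
      simpa [OrientedMatroid.prependComp, signComp, h] using hg
    · simp [OrientedMatroid.prependComp, signComp, h] at hg
  · rintro (_ | i)
    · exact M.comp_mem _ (hX.mem 0).1 _ hY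
    · exact (hX.mem i).1
  · rintro (_ | i)
    · exact signLE_comp _ _
    · exact hX.le i
  · rintro (_ | i) hi
    · refine ⟨e, ?_, (hX.mem 0).2⟩
      simp [OrientedMatroid.prependComp, signComp, (hX.mem 0).2, hYe]
    · exact hX.lt i (by omega)
  · rintro (_ | i) hi f hf1 hf2 g hg
    · have hloop : ¬ M.InClosure ∅ f := fun h' =>
        hf1 (h' _ (M.comp_mem _ (hX.mem 0).1 _ hY) (by simp))
      refine (hcl g hg).trans ?_
      rintro _ rfl
      exact (inClosure_singleton_comm hloop (hcl f hf2)).mono (by simp)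
    · have := hX.cover i (by omega) f hf1 hf2 g hg
      rw [contraction_inClosure_iff] at this
      refine this.mono ?_
      rintro a (rfl | ha)
      · exact Or.inr (hX.mem i).2
      · exact ha
  · rintro (_ | i) hi
    · omega
    · exact hX.tail i (by omega)

/-- The linear map `T ↦ T ∘ Y - T ∘ (-Y)`. -/
noncomputable def compSub (Y : E → SignType) : ((E → SignType) →₀ ℤ) →ₗ[ℤ] (E → SignType) →₀ ℤ :=
  Finsupp.lmapDomain ℤ ℤ (fun T => signComp T Y) - Finsupp.lmapDomain ℤ ℤ (fun T => signComp T (-Y))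

theorem compSub_single (Y T : E → SignType) (a : ℤ) : compSub Y (Finsupp.single T a) =
    Finsupp.single (signComp T Y) a - Finsupp.single (signComp T (-Y)) a := by
  simp [compSub, Finsupp.mapDomain_single]

/-- Split the subsets according to whether they contain the new step `0`: flipping it replaces `Y`
by `-Y` and contributes the sign in `compSub`. -/
theorem flipSum_prependComp {X : ℕ → E → SignType} (hX : SignAntitone X) (Y : E → SignType)
    (p : ℕ) : flipSum (prependComp Y X) (p + 1) = compSub Y (flipSum X p) := by
  classical
  have hX' : SignAntitone (prependComp Y X) := by
    rintro (_ | i)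
    · exact signLE_comp _ _
    · exact hX i
  have hr : Finset.range (p + 1) = insert 0 ((Finset.range p).image Nat.succ) := by
    ext (_ | i) <;> simp
  have h0 : ∀ S : Finset ℕ, 0 ∉ S.image Nat.succ := by simp
  have hinj : Function.Injective (Finset.image Nat.succ) :=
    Finset.image_injective Nat.succ_injective
  have hflip : ∀ S : Finset ℕ,
      flip (prependComp Y X) (S.image Nat.succ) = signComp (flip X S) Y := by
    intro S
    funext e
    by_cases h : X 0 e = 0
    · have h' : ∀ i, X i e = 0 := fun i => hX.eq_zero (Nat.zero_le i) h
      simp [flip, prependComp, signComp, h, h']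
    · have : flip X S e ≠ 0 := fun h' => h (flip_eq_zero_iff.1 h')
      simp only [signComp, this, if_false]
      simp [flip, prependComp, signComp, h]
  have hflip' : ∀ S : Finset ℕ,
      flip (prependComp Y X) (insert 0 (S.image Nat.succ)) = signComp (flip X S) (-Y) := by
    intro S
    funext e
    rw [hX'.flip_insert (h0 S), hflip]
    by_cases h : X 0 e = 0
    · have : flip X S e = 0 := flip_eq_zero_iff.2 h
      by_cases hY : Y e = 0 <;> simp [prependComp, signComp, h, this, hY]
    · have : flip X S e ≠ 0 := fun h' => h (flip_eq_zero_iff.1 h')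
      simp [prependComp, signComp, h, this]
  rw [flipSum, hr, Finset.sum_powerset_insert (h0 _), Finset.powerset_image,
    Finset.sum_image hinj.injOn, Finset.sum_image hinj.injOn, flipSum, map_sum,
    ← Finset.sum_add_distrib]
  refine Finset.sum_congr rfl fun S _ => ?_
  rw [compSub_single, hflip, hflip', Finset.card_insert_of_notMem (h0 S),
    Finset.card_image_of_injective _ Nat.succ_injective, sub_eq_add_neg, ← Finsupp.single_neg]
  congr 2
  ring

theorem mapDomain_signDelete_flipSum {X X' : ℕ → E → SignType} {A : Set E}
    (h : ∀ i, signDelete (X i) A = X' i) (p : ℕ) :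
    Finsupp.lmapDomain ℤ ℤ (fun T => signDelete T A) (flipSum X p) = flipSum X' p := by
  simp only [flipSum, map_sum, Finsupp.lmapDomain_apply, Finsupp.mapDomain_single]
  refine Finset.sum_congr rfl fun S _ => ?_
  congr 1
  funext e
  by_cases he : e ∈ A <;> simp [flip, ← h, signDelete, he]

/-- A deleted entry is `0`, never `+`, so any product containing its Heaviside function vanishes;
all other products do not see the deletion. -/
theorem posEval_lmapDomain_signDelete (A : Set E) (S : Finset E) (γ : (E → SignType) →₀ ℤ) :
    posEval S (Finsupp.lmapDomain ℤ ℤ (fun T => signDelete T A) γ) = 0 ∨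
    posEval S (Finsupp.lmapDomain ℤ ℤ (fun T => signDelete T A) γ) = posEval S γ ∧
      ∀ e ∈ S, e ∉ A := by
  classical
  by_cases h : ∀ e ∈ S, e ∉ A
  · refine Or.inr ⟨?_, h⟩
    induction γ using Finsupp.induction_linear with
    | zero => simp
    | add a b ha hb => simp only [map_add, ha, hb]
    | single T a =>
      rw [Finsupp.lmapDomain_apply, Finsupp.mapDomain_single, posEval_single, posEval_single]
      have : (∀ e ∈ S, signDelete T A e = 1) ↔ ∀ e ∈ S, T e = 1 :=
        forall₂_congr fun e he => by simp [signDelete, h e he]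
      simp only [this]
  · left
    push Not at h
    obtain ⟨e, heS, heA⟩ := h
    induction γ using Finsupp.induction_linear with
    | zero => simp
    | add a b ha hb => simp only [map_add, ha, hb, add_zero]
    | single T a =>
      rw [Finsupp.lmapDomain_apply, Finsupp.mapDomain_single, posEval_single, if_neg]
      exact fun h => by simpa [signDelete, heA] using h e heS

open scoped Classical in
-- Passing to the positive side of `e` is multiplication by `h_e`. This is where the contraction
-- loses one degree.
theorem posEval_filter (e : E) (S : Finset E) (γ : (E → SignType) →₀ ℤ) :
    posEval S (γ.filter fun T => T e = 1) = posEval (insert e S) γ := by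
  induction γ using Finsupp.induction_linear with
  | zero => rw [Finsupp.filter_zero, map_zero, map_zero]
  | add a b ha hb => rw [Finsupp.filter_add, map_add, map_add, ha, hb]
  | single T a =>
    rw [posEval_single]
    by_cases h : T e = 1
    · rw [Finsupp.filter_single_of_pos (fun T : E → SignType => T e = 1) h, posEval_single]
      simp [h]
    · rw [Finsupp.filter_single_of_neg (fun T : E → SignType => T e = 1) h]
      simp [h]

theorem exists_of_lmapDomain_ne_zero {α : Type*} {f : α → α} {γ : α →₀ ℤ} {U : α}
    (h : Finsupp.lmapDomain ℤ ℤ f γ U ≠ 0) : ∃ T, γ T ≠ 0 ∧ f T = U := by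
  classical
  have := Finsupp.mapDomain_support (f := f) (s := γ) (Finsupp.mem_support_iff.2 h)
  simpa using this

theorem lmapDomain_signDelete_mem {p : ℕ} {γ : (E → SignType) →₀ ℤ}
    (hγ : γ ∈ M.lowAnnihilator p) (A : Set E) :
    Finsupp.lmapDomain ℤ ℤ (fun T => signDelete T A) γ ∈ (M.deletion A).lowAnnihilator p := by
  refine ⟨fun U hU => ?_, fun S hS => ?_⟩
  · obtain ⟨T, hT, rfl⟩ := exists_of_lmapDomain_ne_zero hU
    exact (hγ.1 T hT).signDelete A
  · rcases posEval_lmapDomain_signDelete A S γ with h | ⟨h, -⟩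
    · exact h
    · rw [h, hγ.2 S hS]

/-- Split `γ` by the sign at `e` into `γ₁ + γ₂`. Since the deletion kills `γ`, the images of the two
halves are opposite, and the image of `γ₁` is the required element. Composing with `Y` or `-Y`
recovers each half, because the sign at `e` determines all signs on the parallel class. -/
theorem exists_eq_compSub {e : E} {p : ℕ} {γ : (E → SignType) →₀ ℤ}
    (hγ : γ ∈ M.lowAnnihilator (p + 1))
    (h0 : Finsupp.lmapDomain ℤ ℤ (fun T => signDelete T (M.parallelClass e)) γ = 0)
    (he : ¬ M.InClosure ∅ e) {Y : E → SignType} (hY : Y ∈ M.covectors) (hYe : Y e = 1) :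
    ∃ a ∈ (M.contraction e).lowAnnihilator p, compSub Y a = γ := by
  classical
  set A := M.parallelClass e with hA
  set r := Finsupp.lmapDomain ℤ ℤ (fun T : E → SignType => signDelete T A) with hr
  set γ₁ := γ.filter fun T => T e = 1 with hγ₁
  set γ₂ := γ.filter fun T => ¬ T e = 1 with hγ₂
  have hsum : γ₁ + γ₂ = γ := Finsupp.filter_add_filter_not γ _
  have hr0 : r γ₁ = - r γ₂ := by
    rw [eq_neg_iff_add_eq_zero, ← map_add, hsum, h0]
  have h1 : ∀ T, γ₁ T ≠ 0 → γ T ≠ 0 ∧ T e = 1 := by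
    intro T hT
    simp only [hγ₁, Finsupp.filter_apply] at hT
    split_ifs at hT with h
    · exact ⟨hT, h⟩
    · exact absurd rfl hT
  have h2 : ∀ T, γ₂ T ≠ 0 → γ T ≠ 0 ∧ T e = -1 := by
    intro T hT
    simp only [hγ₂, Finsupp.filter_apply] at hT
    split_ifs at hT with h
    · exact absurd rfl hT
    · have : T e ≠ 0 := fun h' => he ((hγ.1 T hT).inClosure_empty h')
      refine ⟨hT, signType_eq_neg_of_ne this one_ne_zero h⟩
  have hcomp : ∀ Z ∈ M.covectors, Z e ≠ 0 → ∀ T, M.IsTope T → T e = Z e →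
      signComp (signDelete T A) Z = T := by
    intro Z hZ hZe T hT hTe
    funext f
    by_cases hf : f ∈ A
    · simp only [signComp, signDelete, hf, if_true]
      exact eq_of_mem_parallelClass hf hZ hT.1 hZe hTe.symm
    · by_cases hTf : T f = 0
      · simp only [signComp, signDelete, hf, hTf, if_false, if_true]
        exact hT.inClosure_empty hTf Z hZ (by simp)
      · simp [signComp, signDelete, hf, hTf]
  have hback : ∀ Z ∈ M.covectors, Z e ≠ 0 → ∀ δ : (E → SignType) →₀ ℤ,
      (∀ T, δ T ≠ 0 → M.IsTope T ∧ T e = Z e) →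
      Finsupp.lmapDomain ℤ ℤ (fun T => signComp T Z) (r δ) = δ := by
    intro Z hZ hZe δ hδ
    rw [hr, Finsupp.lmapDomain_apply, Finsupp.lmapDomain_apply, ← Finsupp.mapDomain_comp]
    conv_rhs => rw [← Finsupp.mapDomain_id (v := δ)]
    refine Finsupp.mapDomain_congr fun T hT => ?_
    obtain ⟨h, h'⟩ := hδ T (Finsupp.mem_support_iff.1 hT)
    exact hcomp Z hZ hZe T h h'
  refine ⟨r γ₁, ⟨fun U hU => ?_, fun S hS => ?_⟩, ?_⟩
  · obtain ⟨T₁, hT₁, rfl⟩ := exists_of_lmapDomain_ne_zero hU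
    obtain ⟨T₂, hT₂, hT⟩ := exists_of_lmapDomain_ne_zero
      (f := fun T : E → SignType => signDelete T A) (γ := γ₂) (U := signDelete T₁ A)
      fun h => hU (by rw [hr0, Finsupp.neg_apply, hr, h, neg_zero])
    have ht₁ := hγ.1 T₁ (h1 T₁ hT₁).1
    have ht₂ := hγ.1 T₂ (h2 T₂ hT₂).1
    -- A vector surviving in the image of `γ₁` is the restriction of two topes on opposite sides of
    -- `e`. They agree off `A`, so eliminating `e` yields this vector itself, which is therefore a
    -- covector vanishing at `e`.
    obtain ⟨Z, hZ, hZe, hZ'⟩ := M.elimination T₁ ht₁.1 T₂ ht₂.1 e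
      (by simp [(h1 T₁ hT₁).2]) (by simp [(h1 T₁ hT₁).2, (h2 T₂ hT₂).2])
    have hZU : Z = signDelete T₁ A := by
      funext f
      by_cases hf : f ∈ A
      · simp [signDelete, hf, (eq_zero_iff_of_mem_parallelClass hf hZ).2 hZe]
      · have h12 : T₂ f = T₁ f := by simpa [signDelete, hf] using congrFun hT f
        have hsep : ¬ (T₁ f ≠ 0 ∧ T₁ f = -T₂ f) := by
          rw [h12]
          generalize T₁ f = s
          revert s
          decide
        rw [hZ' f hsep]
        by_cases h : T₁ f = 0 <;> simp [signDelete, signComp, hf, h, h12]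
    rw [isTope_iff]
    refine ⟨⟨hZU ▸ hZ, hZU ▸ hZe⟩, ?_⟩
    rintro f hf W ⟨hW, hWe⟩
    by_cases hfA : f ∈ A
    · exact (eq_zero_iff_of_mem_parallelClass hfA hW).2 hWe
    · exact ht₁.inClosure_empty (by simpa [signDelete, hfA] using hf) W hW (by simp)
  · rcases posEval_lmapDomain_signDelete A S γ₁ with h | ⟨h, -⟩
    · exact h
    · rw [hr, h, hγ₁, posEval_filter]
      exact hγ.2 _ ((Finset.card_insert_le e S).trans_lt (by omega))
  · have e1 := hback Y hY (by simp [hYe]) γ₁ fun T hT =>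
      ⟨hγ.1 T (h1 T hT).1, (h1 T hT).2.trans hYe.symm⟩
    have e2 := hback (-Y) (M.neg_mem Y hY) (by simp [hYe]) γ₂ fun T hT =>
      ⟨hγ.1 T (h2 T hT).1, by simp [(h2 T hT).2, hYe]⟩
    rw [compSub, LinearMap.sub_apply, e1, hr0, map_neg, e2, sub_neg_eq_add, hsum]

theorem flipSum_zero (T : E → SignType) : flipSum (fun _ => T) 0 = Finsupp.single T 1 := by
  simp [flipSum, flip_empty]

theorem lowAnnihilator_zero_le_flipSpan (M : OrientedMatroid E) :
    M.lowAnnihilator 0 ≤ M.flipSpan 0 := by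
  intro γ hγ
  rw [← Finsupp.sum_single γ]
  refine Submodule.sum_mem _ fun T hT => ?_
  have hT' := hγ.1 T (Finsupp.mem_support_iff.1 hT)
  have : Finsupp.single T (γ T) = γ T • flipSum (fun _ => T) 0 := by
    rw [flipSum_zero, Finsupp.smul_single, smul_eq_mul, mul_one]
  rw [this]
  refine Submodule.smul_mem _ _ (Submodule.subset_span ⟨_, ⟨hT', fun _ => hT'.1, ?_, ?_, ?_, ?_⟩, rfl⟩)
  · exact fun _ _ _ => rfl
  · exact fun i hi => absurd hi (by omega)
  · exact fun i hi => absurd hi (by omega)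
  · exact fun _ _ => rfl

/-- Induction on the number of non-loops: both minors at a non-loop `e` turn `e` into a loop and
keep all old loops. A combination of flip sums with the same deletion as `γ` is subtracted, and the
difference is lifted from the contraction. -/
theorem lowAnnihilator_le_flipSpan [Finite E] (M : OrientedMatroid E) (p : ℕ) :
    M.lowAnnihilator p ≤ M.flipSpan p := by
  induction hn : {e | ¬ M.InClosure ∅ e}.ncard using Nat.strong_induction_on
    generalizing M p with
  | _ n ih =>
  rcases p with _ | p
  · exact M.lowAnnihilator_zero_le_flipSpan
  intro γ hγ
  -- With only loops, the zero vector is the only tope, and the empty product, allowed because the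
  -- degree bound is positive, kills its coefficient.
  by_cases hloop : ∀ e, M.InClosure ∅ e
  · have hsupp : γ = Finsupp.single 0 (γ 0) := by
      ext T
      by_cases hT : T = 0
      · simp [hT]
      · rw [Finsupp.single_eq_of_ne hT]
        by_contra h
        exact hT (funext fun e => hloop e T (hγ.1 T h).1 (by simp))
    have h0 := hγ.2 ∅ (by simp)
    classical
    rw [hsupp, posEval_single] at h0
    rw [hsupp, show γ 0 = 0 by simpa using h0, Finsupp.single_zero]
    exact Submodule.zero_mem _
  push Not at hloop
  obtain ⟨e, he⟩ := hloop
  have hlt : ∀ N : OrientedMatroid E, N.InClosure ∅ e →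
      (∀ f, M.InClosure ∅ f → N.InClosure ∅ f) → ∀ q, N.lowAnnihilator q ≤ N.flipSpan q := by
    intro N hNe hN q
    refine ih _ ?_ N q rfl
    rw [← hn]
    exact Set.ncard_lt_ncard ⟨fun f hf h => hf (hN f h), fun h => h he hNe⟩ (Set.toFinite _)
  set A := M.parallelClass e with hA
  have heA : e ∈ A := ⟨he, M.inClosure_of_mem rfl⟩
  have hdel := hlt (M.deletion A)
    (by rintro _ ⟨X, -, rfl⟩ -; simp [signDelete, heA])
    (by rintro f hf _ ⟨X, hX, rfl⟩ -; simp [signDelete, hf X hX (by simp)]) (p + 1)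
  have hcon := hlt (M.contraction e) (fun X hX _ => hX.2) (fun f hf X hX => hf X hX.1) p
  set r := Finsupp.lmapDomain ℤ ℤ (fun T : E → SignType => signDelete T A) with hr
  obtain ⟨δ, hδ, hδr⟩ : ∃ δ ∈ M.flipSpan (p + 1), r δ = r γ := by
    have h : (M.deletion A).flipSpan (p + 1) ≤ (M.flipSpan (p + 1)).map r := by
      refine Submodule.span_le.2 ?_
      rintro _ ⟨X', hX', rfl⟩
      obtain ⟨X, hX, hXX'⟩ := exists_isCoverChain_of_deletion he hX'
      exact ⟨flipSum X (p + 1), Submodule.subset_span ⟨X, hX, rfl⟩,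
        mapDomain_signDelete_flipSum hXX' _⟩
    exact h (hdel (lmapDomain_signDelete_mem hγ A))
  obtain ⟨Y, hY, hYe⟩ : ∃ Y ∈ M.covectors, Y e = 1 := by
    simp only [InClosure, not_forall] at he
    obtain ⟨Z, hZ, -, hZe⟩ := he
    rcases hs : Z e with _ | _ | _
    · exact absurd hs hZe
    · exact ⟨-Z, M.neg_mem Z hZ, by simp [hs]⟩
    · exact ⟨Z, hZ, hs⟩
  obtain ⟨a, ha, hac⟩ := exists_eq_compSub (e := e) (p := p) (γ := γ - δ)
    (sub_mem hγ (M.flipSpan_le _ hδ)) (by rw [map_sub, ← hA, ← hr, hδr, sub_self]) he hY hYe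
  have hspan : (M.contraction e).flipSpan p ≤ (M.flipSpan (p + 1)).comap (compSub Y) := by
    refine Submodule.span_le.2 ?_
    rintro _ ⟨X, hX, rfl⟩
    refine Submodule.subset_span ⟨prependComp Y X, hX.prependComp hY (by simp [hYe]), ?_⟩
    exact flipSum_prependComp hX.le Y p
  have := hspan (hcon ha)
  rw [Submodule.mem_comap, hac] at this
  simpa using add_mem this hδ

end Span

/-- A sign vector that is a tope, as an element of the set of topes. -/
def IsTope.toTope {E : Type*} {M : OrientedMatroid E} {T : E → SignType} (hT : M.IsTope T) :
    M.Tope := ⟨T, hT⟩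

/-- The sign vector of a tope. -/
def Tope.signs {E : Type*} {M : OrientedMatroid E} (T : M.Tope) : E → SignType := T.1

theorem Tope.signs_injective {E : Type*} {M : OrientedMatroid E} :
    Function.Injective (Tope.signs : M.Tope → E → SignType) := fun _ _ h => Subtype.ext h

/-! ### Kalinin witnesses for flip sums in the Salvetti complex -/

section Kalinin

variable {E : Type*} {M : OrientedMatroid E} {p : ℕ} {X : ℕ → E → SignType}

theorem IsCoverChain.signAntitone (hX : M.IsCoverChain p X) : SignAntitone X := hX.le

theorem IsCoverChain.isTope_flip (hX : M.IsCoverChain p X) (S : Finset ℕ) :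
    M.IsTope (flip X S) :=
  hX.signAntitone.isTope_flip hX.mem hX.isTope S

theorem IsCoverChain.flipFace_mem (hX : M.IsCoverChain p X) (i : ℕ) (S : Finset ℕ) :
    flipFace X i S ∈ M.covectors :=
  hX.signAntitone.flipFace_mem hX.mem S i

/-- The cell `Z(L, T)` for `T = flip X S` and `L` its restriction to the support of `X i`. -/
noncomputable def IsCoverChain.flipCell (hX : M.IsCoverChain p X) (i : ℕ) (S : Finset ℕ) :
    M.SalvettiCell :=
  cell (hX.flipFace_mem i S) (hX.isTope_flip S)

theorem IsCoverChain.flipCell_covector (hX : M.IsCoverChain p X) (i : ℕ) (S : Finset ℕ) :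
    (hX.flipCell i S).covector = flipFace X i S := rfl

theorem IsCoverChain.flipCell_tope (hX : M.IsCoverChain p X) (i : ℕ) (S : Finset ℕ) :
    (hX.flipCell i S).tope = flip X S := by
  funext e
  change signComp (flipFace X i S) (flip X S) e = _
  by_cases h : X i e = 0
  · simp [signComp, flipFace_of_eq_zero h]
  · by_cases h' : flip X S e = 0 <;> simp [signComp, flipFace_of_ne_zero h, h']

theorem IsCoverChain.flipCell_zero (hX : M.IsCoverChain p X) (S : Finset ℕ) :
    hX.flipCell 0 S = vertex (hX.isTope_flip S).toTope := by
  refine SalvettiCell.ext ?_ ?_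
  · rw [flipCell_covector, flipFace_zero]
    rfl
  · rw [flipCell_tope]
    rfl

/-- Conjugation negates the tope on the zero set of `X i`. Apart from loops, this set is the
disjoint union of the steps below `i`, so exactly these steps are toggled. -/
theorem IsCoverChain.conj_flipCell (hX : M.IsCoverChain p X) (i : ℕ) (S : Finset ℕ) :
    (hX.flipCell i S).conj = hX.flipCell i (symmDiff S (Finset.range i)) := by
  have hface : flipFace X i S = flipFace X i (symmDiff S (Finset.range i)) := by
    refine hX.signAntitone.flipFace_congr fun j hj => ?_
    have : ¬ j < i := by omega
    simp [Finset.mem_symmDiff, this]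
  refine SalvettiCell.ext hface ?_
  rw [flipCell_tope]
  funext e
  change signComp (flipFace X i S) (-(hX.flipCell i S).tope) e = _
  rw [flipCell_tope]
  by_cases h : X i e = 0
  · simp only [signComp, flipFace_of_eq_zero h, if_true, Pi.neg_apply]
    by_cases h0 : X 0 e = 0
    · rw [flip_eq_zero_iff.2 h0, flip_eq_zero_iff.2 h0, neg_zero]
    · obtain ⟨j, hj, hj1, hj2⟩ := exists_drop h0 h
      rw [hX.signAntitone.flip_of_drop _ hj1 hj2, hX.signAntitone.flip_of_drop _ hj1 hj2]
      by_cases hS : j ∈ S <;> simp [Finset.mem_symmDiff, hS, hj]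
  · have h0 : flipFace X i S e ≠ 0 := fun h' => h (hX.signAntitone.flipFace_eq_zero_iff.1 h')
    simp only [signComp, h0, if_false]
    rw [hface, flipFace_of_ne_zero h]

/-- The sum of the cells `Z(flip X S \ F_i, flip X S)`, `S ⊆ {0, …, p - 1}`. -/
noncomputable def IsCoverChain.fullChain (hX : M.IsCoverChain p X) (i : ℕ) : M.SalvettiChain :=
  ∑ S ∈ (Finset.range p).powerset, Finsupp.single (hX.flipCell i S) 1

/-- The sum of the cells `Z(flip X S \ F_i, flip X S)`, `S ⊆ {0, …, p - 1} \ {i - 1}`. -/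
noncomputable def IsCoverChain.halfChain (hX : M.IsCoverChain p X) (i : ℕ) : M.SalvettiChain :=
  ∑ S ∈ ((Finset.range p).erase (i - 1)).powerset, Finsupp.single (hX.flipCell i S) 1

theorem IsCoverChain.fullChain_eq (hX : M.IsCoverChain p X) (i : ℕ) {k : ℕ} (hk : k < p) :
    hX.fullChain i = ∑ S ∈ ((Finset.range p).erase k).powerset,
      (Finsupp.single (hX.flipCell i S) 1 + Finsupp.single (hX.flipCell i (insert k S)) 1) := by
  have hr : Finset.range p = insert k ((Finset.range p).erase k) :=
    (Finset.insert_erase (by simpa using hk)).symm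
  rw [fullChain, hr, Finset.sum_powerset_insert (Finset.notMem_erase _ _),
    ← Finset.sum_add_distrib, ← hr]

theorem IsCoverChain.halfChain_add_conjChain (hX : M.IsCoverChain p X) {i : ℕ} (hi : 1 ≤ i)
    (hip : i ≤ p) : hX.halfChain i + M.conjChain (hX.halfChain i) = hX.fullChain i := by
  obtain ⟨k, rfl⟩ : ∃ k, i = k + 1 := ⟨i - 1, by omega⟩
  rw [hX.fullChain_eq (k + 1) (k := k) (by omega), Finset.sum_add_distrib, halfChain,
    Nat.add_sub_cancel]
  congr 1
  simp only [map_sum, conjChain, Finsupp.lmapDomain_apply, Finsupp.mapDomain_single,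
    conj_flipCell]
  have hmem : ∀ S ∈ ((Finset.range p).erase k).powerset,
      symmDiff S (Finset.range k) ∈ ((Finset.range p).erase k).powerset := by
    intro S hS
    rw [Finset.mem_powerset] at hS ⊢
    intro a ha
    rcases Finset.mem_symmDiff.1 ha with ⟨h, -⟩ | ⟨h, -⟩
    · exact hS h
    · rw [Finset.mem_range] at h
      simp only [Finset.mem_erase, Finset.mem_range]
      omega
  -- Toggling the steps below `k + 1` amounts to toggling those below `k`, a bijection of the index
  -- sets, and then inserting `k`, which no index contains.
  refine Finset.sum_nbij' (fun S => symmDiff S (Finset.range k))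
    (fun S => symmDiff S (Finset.range k)) hmem hmem ?_ ?_ ?_
  · intro S _
    exact symmDiff_symmDiff_cancel_right _ _
  · intro S _
    exact symmDiff_symmDiff_cancel_right _ _
  · intro S hS
    congr 2
    have hkS : k ∉ S := fun h => Finset.notMem_erase k _ (Finset.mem_powerset.1 hS h)
    ext a
    simp only [Finset.mem_symmDiff, Finset.mem_range, Finset.mem_insert]
    rcases eq_or_ne a k with rfl | h
    · simp [hkS]
    · have : a < k + 1 ↔ a < k := by omega
      simp [this, h]

theorem IsCoverChain.flipCell_le (hX : M.IsCoverChain p X) {i : ℕ} {S S' : Finset ℕ}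
    (h : ∀ j, j ≠ i → (j ∈ S ↔ j ∈ S')) : hX.flipCell i S' ≤ hX.flipCell (i + 1) S := by
  refine ⟨fun e he => ?_, ?_⟩
  · rw [flipCell_covector] at he ⊢
    have h1 : X (i + 1) e ≠ 0 := fun h0 => he (flipFace_of_eq_zero h0)
    have h2 : X i e ≠ 0 := fun h0 => h1 (hX.signAntitone.eq_zero (Nat.le_succ i) h0)
    rw [flipCell_covector, flipFace_of_ne_zero h1, flipFace_of_ne_zero h2]
    refine flip_congr fun j _ hj => h j ?_
    rintro rfl
    exact h1 hj
  · rw [flipCell_tope, flipCell_tope, flipCell_covector]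
    funext e
    by_cases h0 : X i e = 0
    · simp only [signComp, flipFace_of_eq_zero h0, if_true]
      refine flip_congr fun j hj _ => (h j ?_).symm
      rintro rfl
      exact hj h0
    · have h1 : flipFace X i S' e ≠ 0 := fun h' => h0 (hX.signAntitone.flipFace_eq_zero_iff.1 h')
      simp only [signComp, h1, if_false]
      rw [flipFace_of_ne_zero h0]

/-- The tope of a face `c` depends on the ambient tope only on the zero set of `c.covector`. If this
set misses step `j`, flipping step `j` has no effect on whether `c` is a face. -/
theorem IsCoverChain.le_flipCell_insert_iff (hX : M.IsCoverChain p X) {i j : ℕ} (hj : j < i)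
    {S : Finset ℕ} (hjS : j ∉ S) {c : M.SalvettiCell}
    (hc : ∀ e, c.covector e = 0 → ¬ (X j e ≠ 0 ∧ X (j + 1) e = 0)) :
    c ≤ hX.flipCell i (insert j S) ↔ c ≤ hX.flipCell i S := by
  have hface : flipFace X i (insert j S) = flipFace X i S := by
    refine hX.signAntitone.flipFace_congr fun k hk => ?_
    have : k ≠ j := by omega
    simp [this]
  have hcomp : signComp c.covector (flip X (insert j S)) = signComp c.covector (flip X S) := by
    funext e
    by_cases h : c.covector e = 0
    · simp only [signComp, h, if_true]
      rw [hX.signAntitone.flip_insert hjS, if_neg (hc e h)]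
    · simp [signComp, h]
  change _ ∧ _ ↔ _ ∧ _
  rw [flipCell_covector, flipCell_covector, flipCell_tope, flipCell_tope, hface, hcomp]

/-- Outside `F_{i+1}` the covector of `c` is prescribed by the big cell. On `F_{i+1} \ F_i` all
signs are determined by the one at a single element `e₀`, since any element there spans `F_{i+1}`
over `F_i`. The two possible signs give the two cells. -/
theorem IsCoverChain.eq_flipCell (hX : M.IsCoverChain p X) {i : ℕ} (hi : i < p) {S : Finset ℕ}
    (hS : i ∉ S) {c : M.SalvettiCell} (hc : c ≤ hX.flipCell (i + 1) S)
    (hz : {e | c.covector e = 0} = {e | X i e = 0}) :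
    c = hX.flipCell i S ∨ c = hX.flipCell i (insert i S) := by
  have hz' : ∀ e, c.covector e = 0 ↔ X i e = 0 := fun e => Set.ext_iff.1 hz e
  obtain ⟨e₀, he₀, he₀'⟩ := hX.lt i hi
  have key : ∀ S', (∀ j, j ≠ i → (j ∈ S ↔ j ∈ S')) → c.covector e₀ = flip X S' e₀ →
      c = hX.flipCell i S' := by
    intro S' hSS' heq
    have hcov : c.covector = flipFace X i S' := by
      funext e
      by_cases h0 : X i e = 0
      · rw [(hz' e).2 h0, flipFace_of_eq_zero h0]
      · by_cases h1 : X (i + 1) e = 0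
        · refine eq_of_inClosure_insert (hX.cover i hi e h0 h1 e₀ he₀') c.covector_mem
            (hX.flipFace_mem i S') (fun g hg => (hz' g).2 hg)
            (fun g hg => flipFace_of_eq_zero hg) ?_ fun h => he₀ ((hz' e₀).1 h)
          rw [heq, flipFace_of_ne_zero he₀]
        · have h2 := hc.1 e (by
            rw [flipCell_covector]
            exact fun h => h1 (hX.signAntitone.flipFace_eq_zero_iff.1 h))
          rw [← h2, flipCell_covector, flipFace_of_ne_zero h1, flipFace_of_ne_zero h0]
          refine flip_congr fun j _ hj => hSS' j ?_
          rintro rfl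
          exact h1 hj
    refine SalvettiCell.ext hcov ?_
    have h1 := hc.2
    have h2 := (hX.flipCell_le hSS').2
    rw [h1, h2, hcov, flipCell_covector]
  have hflip := hX.signAntitone.flip_insert hS e₀
  rw [if_pos ⟨he₀, he₀'⟩] at hflip
  by_cases h : c.covector e₀ = flip X S e₀
  · exact Or.inl (key S (fun _ _ => Iff.rfl) h)
  · refine Or.inr (key (insert i S) (fun j hj => by simp [hj]) ?_)
    rw [hflip]
    refine signType_eq_neg_of_ne (fun h0 => he₀ ((hz' e₀).1 h0)) (fun h0 => ?_) h
    exact he₀ (hX.signAntitone.eq_zero (Nat.zero_le i) (flip_eq_zero_iff.1 h0))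

variable [Finite E]

theorem eRk_ne_top (A : Set E) : M.underlyingMatroid.eRk A ≠ ⊤ :=
  ne_top_of_le_ne_top (Set.toFinite A).encard_lt_top.ne (M.underlyingMatroid.eRk_le_encard A)

theorem closure_zeroSet {Y : E → SignType} (hY : Y ∈ M.covectors) :
    M.underlyingMatroid.closure {e | Y e = 0} = {e | Y e = 0} :=
  ((M.isFlat_underlyingMatroid_iff _).2 ⟨Y, hY, rfl⟩).closure

theorem closure_eq_closure_of_eRk_le {A B : Set E} (h : A ⊆ B)
    (hr : M.underlyingMatroid.eRk B ≤ M.underlyingMatroid.eRk A) :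
    M.underlyingMatroid.closure A = M.underlyingMatroid.closure B :=
  (Matroid.eRk_ne_top_iff.1 (eRk_ne_top A)).closure_eq_closure_of_subset_of_eRk_ge_eRk h hr

theorem add_one_le_eRk {A B : Set E} {e : E} (h : A ⊆ B) (heB : e ∈ B)
    (heA : e ∉ M.underlyingMatroid.closure A) :
    M.underlyingMatroid.eRk A + 1 ≤ M.underlyingMatroid.eRk B := by
  rw [← Matroid.eRk_insert_eq_add_one ⟨Set.mem_univ e, heA⟩]
  exact M.underlyingMatroid.eRk_mono (Set.insert_subset heB h)

theorem IsCoverChain.eRk_zeroSet (hX : M.IsCoverChain p X) (hl : ∀ e, ¬ M.InClosure ∅ e)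
    {i : ℕ} (hi : i ≤ p) : M.underlyingMatroid.eRk {e | X i e = 0} = i := by
  induction i with
  | zero =>
    have : {e | X 0 e = 0} = ∅ :=
      Set.eq_empty_of_forall_notMem fun e he => hl e (hX.isTope.inClosure_empty he)
    simp [this]
  | succ i ih =>
    obtain ⟨e, he, he'⟩ := hX.lt i (by omega)
    have hcl : M.underlyingMatroid.closure (insert e {g | X i g = 0}) = {g | X (i + 1) g = 0} := by
      ext f
      rw [mem_closure_underlyingMatroid_iff]
      refine ⟨fun h => h _ (hX.mem (i + 1)) ?_, hX.cover i (by omega) e he he' f⟩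
      rintro a (rfl | ha)
      exacts [he', hX.signAntitone.eq_zero (Nat.le_succ i) ha]
    rw [← hcl, Matroid.eRk_closure_eq, Matroid.eRk_insert_eq_add_one, ih (by omega)]
    · push_cast
      rfl
    · refine ⟨Set.mem_univ e, ?_⟩
      rwa [closure_zeroSet (hX.mem i)]

theorem IsCoverChain.dim_flipCell (hX : M.IsCoverChain p X) (hl : ∀ e, ¬ M.InClosure ∅ e)
    {i : ℕ} (hi : i ≤ p) (S : Finset ℕ) : (hX.flipCell i S).dim = i := by
  have : {e | flipFace X i S e = 0} = {e | X i e = 0} :=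
    Set.ext fun e => hX.signAntitone.flipFace_eq_zero_iff
  rw [SalvettiCell.dim, flipCell_covector, covectorDim, this, hX.eRk_zeroSet hl hi]
  rfl

/-- A covector of dimension `i` whose zero set meets all differences `F_{j+1} \ F_j`, `j < i`,
has zero set `F_i`. -/
theorem IsCoverChain.zeroSet_eq (hX : M.IsCoverChain p X) (hl : ∀ e, ¬ M.InClosure ∅ e)
    {i : ℕ} (hi : i ≤ p) {L : E → SignType} (hL : L ∈ M.covectors) (hdim : M.covectorDim L = i)
    (h : ∀ j < i, ∃ e, L e = 0 ∧ X j e ≠ 0 ∧ X (j + 1) e = 0) :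
    {e | L e = 0} = {e | X i e = 0} := by
  have hrk : M.underlyingMatroid.eRk {e | L e = 0} = i := by
    rw [← hdim, covectorDim, ENat.natCast_toNat (eRk_ne_top _)]
  -- An element of the zero set of `L` in step `k` lies outside the flat `F_k`, so each step raises
  -- the rank of the intersection. At `k = i` the intersection has the full rank of the zero set of
  -- `L`, which is thus contained in `F_i`; equality follows from equal ranks.
  have hle : ∀ k ≤ i, (k : ℕ∞) ≤ M.underlyingMatroid.eRk ({e | L e = 0} ∩ {e | X k e = 0}) := by
    intro k hk
    induction k with
    | zero => simp
    | succ k ih =>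
      obtain ⟨e, he, he1, he2⟩ := h k (by omega)
      push_cast
      refine (add_le_add_left (ih (by omega)) 1).trans (add_one_le_eRk (e := e) ?_ ⟨he, he2⟩ ?_)
      · exact Set.inter_subset_inter_right _ fun a ha =>
          hX.signAntitone.eq_zero (Nat.le_succ k) ha
      · intro hcl
        have := M.underlyingMatroid.closure_mono Set.inter_subset_right hcl
        rw [closure_zeroSet (hX.mem k)] at this
        exact he1 this
  have h1 := closure_eq_closure_of_eRk_le (M := M) Set.inter_subset_left
    (hrk.trans_le (hle i le_rfl))
  rw [closure_zeroSet hL] at h1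
  have hsub : {e | L e = 0} ⊆ {e | X i e = 0} := by
    have h := M.underlyingMatroid.closure_mono
      (Set.inter_subset_right (s := {e | L e = 0}) (t := {e | X i e = 0}))
    rwa [h1, closure_zeroSet (hX.mem i)] at h
  have h2 := closure_eq_closure_of_eRk_le (M := M) hsub (by rw [hrk, hX.eRk_zeroSet hl hi])
  rwa [closure_zeroSet hL, closure_zeroSet (hX.mem i)] at h2

/-- The codimension-one faces with zero set `F_i` are two per cell, indexed by `S` and `insert i S`,
and together exhaust `fullChain i`. The remaining faces cancel mod 2. -/
theorem IsCoverChain.boundary_halfChain (hX : M.IsCoverChain p X)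
    (hl : ∀ e, ¬ M.InClosure ∅ e) {i : ℕ} (hi : i < p) :
    M.boundary (hX.halfChain (i + 1)) = hX.fullChain i := by
  classical
  let _ := Fintype.ofFinite M.SalvettiCell
  let good : M.SalvettiCell → Prop := fun c => {e | c.covector e = 0} = {e | X i e = 0}
  let face : M.SalvettiCell → Finset ℕ → Prop := fun c S =>
    c ≤ hX.flipCell (i + 1) S ∧ c.dim = i
  have hb : ∀ S, M.boundary (Finsupp.single (hX.flipCell (i + 1) S) 1) =
      ∑ c : M.SalvettiCell, if face c S then Finsupp.single c 1 else 0 := by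
    intro S
    rw [boundary, Finsupp.linearCombination_single, one_smul, Finset.sum_filter]
    refine Finset.sum_congr rfl fun c _ => ?_
    rw [hX.dim_flipCell hl (by omega)]
    simp [face]
  rw [hX.fullChain_eq i hi, halfChain, Nat.add_sub_cancel, map_sum]
  have hsplit : ∀ S ∈ ((Finset.range p).erase i).powerset,
      M.boundary (Finsupp.single (hX.flipCell (i + 1) S) 1) =
      (Finsupp.single (hX.flipCell i S) 1 + Finsupp.single (hX.flipCell i (insert i S)) 1) +
      ∑ c : M.SalvettiCell, if face c S ∧ ¬ good c then Finsupp.single c 1 else 0 := by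
    intro S hS
    have hiS : i ∉ S := fun h => Finset.notMem_erase i _ (Finset.mem_powerset.1 hS h)
    have hpair : (Finset.univ.filter fun c => face c S ∧ good c) =
        {hX.flipCell i S, hX.flipCell i (insert i S)} := by
      ext c
      simp only [Finset.mem_filter, Finset.mem_univ, true_and, Finset.mem_insert,
        Finset.mem_singleton]
      refine ⟨fun h => hX.eq_flipCell hi hiS h.1.1 h.2, ?_⟩
      rintro (rfl | rfl)
      · exact ⟨⟨hX.flipCell_le fun _ _ => Iff.rfl, hX.dim_flipCell hl hi.le S⟩,
          Set.ext fun e => hX.signAntitone.flipFace_eq_zero_iff⟩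
      · exact ⟨⟨hX.flipCell_le fun j hj => by simp [hj], hX.dim_flipCell hl hi.le _⟩,
          Set.ext fun e => hX.signAntitone.flipFace_eq_zero_iff⟩
    have hne : hX.flipCell i S ≠ hX.flipCell i (insert i S) := by
      intro h
      obtain ⟨e, he, he'⟩ := hX.lt i hi
      have h1 := congrFun (congrArg SalvettiCell.tope h) e
      rw [flipCell_tope, flipCell_tope, hX.signAntitone.flip_insert hiS, if_pos ⟨he, he'⟩] at h1
      have h2 : flip X S e ≠ 0 := fun h0 =>
        he (hX.signAntitone.eq_zero (Nat.zero_le i) (flip_eq_zero_iff.1 h0))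
      revert h1 h2
      generalize flip X S e = s
      revert s
      decide
    rw [← Finset.sum_pair (f := fun c => Finsupp.single c (1 : ZMod 2)) hne, ← hpair, Finset.sum_filter, hb, ← Finset.sum_add_distrib]
    refine Finset.sum_congr rfl fun c _ => ?_
    by_cases h1 : face c S <;> by_cases h2 : good c <;> simp [h1, h2]
  rw [Finset.sum_congr rfl hsplit, Finset.sum_add_distrib, add_eq_left, Finset.sum_comm]
  refine Finset.sum_eq_zero fun c _ => ?_
  -- If the zero set of `c` misses step `j`, then `c` occurs for `S` and for `insert j S` alike. If
  -- it misses none, `zeroSet_eq` forces zero set `F_i`, so `c` does not contribute to this sum.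
  by_cases hc : ∃ j < i, ∀ e, c.covector e = 0 → ¬ (X j e ≠ 0 ∧ X (j + 1) e = 0)
  · obtain ⟨j, hj, hcj⟩ := hc
    have hr : (Finset.range p).erase i = insert j (((Finset.range p).erase i).erase j) := by
      refine (Finset.insert_erase ?_).symm
      simp only [Finset.mem_erase, Finset.mem_range]
      omega
    rw [hr, Finset.sum_powerset_insert (Finset.notMem_erase _ _), ← Finset.sum_add_distrib]
    refine Finset.sum_eq_zero fun S hS => ?_
    have hjS : j ∉ S := fun h => Finset.notMem_erase j _ (Finset.mem_powerset.1 hS h)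
    have hiff : face c (insert j S) ↔ face c S :=
      and_congr_left fun _ => hX.le_flipCell_insert_iff (by omega) hjS hcj
    simp only [hiff]
    exact ZModModule.add_self _
  · push Not at hc
    refine Finset.sum_eq_zero fun S _ => if_neg ?_
    rintro ⟨⟨-, hdim⟩, hbad⟩
    exact hbad (hX.zeroSet_eq hl hi.le c.covector_mem hdim hc)

/-- The sum of all topes `flip X S` with `S ⊆ {0, …, p - 1}`. -/
noncomputable def IsCoverChain.flipSumMod2 (hX : M.IsCoverChain p X) : M.TopeSpace (ZMod 2) :=
  ∑ S ∈ (Finset.range p).powerset,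
    Finsupp.single (hX.isTope_flip S).toTope 1

theorem IsCoverChain.isKalininWitness (hX : M.IsCoverChain p X)
    (hl : ∀ e, ¬ M.InClosure ∅ e) : M.IsKalininWitness hX.flipSumMod2 p hX.halfChain where
  mem_chains i _ hi := by
    refine Submodule.sum_mem _ fun S _ => ?_
    exact Finsupp.single_mem_supported _ _ (hX.dim_flipCell hl hi S)
  boundary_one hp := by
    rw [hX.boundary_halfChain hl hp, fullChain, flipSumMod2, map_sum]
    refine Finset.sum_congr rfl fun S _ => ?_
    rw [hX.flipCell_zero, fixedInclusion, Finsupp.lmapDomain_apply, Finsupp.mapDomain_single]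
  boundary_succ i hi hip := by
    rw [hX.boundary_halfChain hl hip, hX.halfChain_add_conjChain hi hip.le]

end Kalinin

/-! ### From the dual degree filtration to the Kalinin filtration -/

section DualDegree

variable {E : Type*} {M : OrientedMatroid E} {p : ℕ}

theorem prod_heaviside (S : Finset E) (T : M.Tope) [Decidable (∀ e ∈ S, T.1 e = 1)] :
    (∏ e ∈ S, M.heaviside e) T = if ∀ e ∈ S, T.1 e = 1 then 1 else 0 := by
  classical
  rw [Finset.prod_apply]
  simp only [heaviside]
  split_ifs with h
  · exact Finset.prod_eq_one fun e he => if_pos (h e he)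
  · push Not at h
    obtain ⟨e, he, h⟩ := h
    exact Finset.prod_eq_zero he (if_neg h)

theorem prod_heaviside_mem_degreeFiltration (S : Finset E) {k : ℤ} (hS : (S.card : ℤ) ≤ k) :
    (∏ e ∈ S, M.heaviside e) ∈ M.degreeFiltration k := by
  refine Or.inr ⟨∏ e ∈ S, MvPolynomial.X e, le_trans ?_ hS, by simp⟩
  have h := MvPolynomial.totalDegree_finsetProd S fun e => (MvPolynomial.X e : MvPolynomial E ℤ)
  simp only [MvPolynomial.totalDegree_X, Finset.sum_const, smul_eq_mul, mul_one] at h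
  exact_mod_cast h

/-- Squarefree monomials suffice as test functions: a product of fewer than `p` Heaviside functions
has degree at most `p - 1`. Topes are viewed as plain sign vectors so that `M` and its minors share
one ambient module. -/
theorem mapDomain_signs_mem_lowAnnihilator {γ : M.TopeSpace ℤ} (hγ : γ ∈ M.dualDegree p) :
    Finsupp.lmapDomain ℤ ℤ (Tope.signs : M.Tope → E → SignType) γ ∈ M.lowAnnihilator p := by
  classical
  refine ⟨fun T hT => ?_, fun S hS => ?_⟩
  · have := Finsupp.mapDomain_support (f := (Tope.signs : M.Tope → E → SignType)) (s := γ)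
      (Finsupp.mem_support_iff.2 hT)
    obtain ⟨U, -, rfl⟩ := Finset.mem_image.1 this
    exact U.2
  · have hmem : (∏ e ∈ S, M.heaviside e) ∈ M.degreeFiltration ((p : ℤ) - 1) :=
      prod_heaviside_mem_degreeFiltration S (by omega)
    simp only [dualDegree, Submodule.mem_iInf] at hγ
    have := hγ _ hmem
    rw [LinearMap.mem_ker] at this
    rw [← this, posEval, Finsupp.lmapDomain_apply, Finsupp.linearCombination_mapDomain]
    congr 2
    funext T
    rw [prod_heaviside]
    change ite (∀ e ∈ S, T.1 e = 1) _ _ = _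
    by_cases h : ∀ e ∈ S, T.1 e = 1
    · rw [if_pos h]
    · rw [if_neg h]

/-- Restriction of a formal sum of sign vectors to the topes, reduced modulo 2. -/
noncomputable def restrictMod2 (M : OrientedMatroid E) :
    ((E → SignType) →₀ ℤ) →+ M.TopeSpace (ZMod 2) :=
  M.mod2.comp (Finsupp.comapDomain.addMonoidHom Tope.signs_injective)

theorem mod2_single (T : M.Tope) (n : ℤ) :
    M.mod2 (Finsupp.single T n) = Finsupp.single T (n : ZMod 2) :=
  Finsupp.mapRange_single (hf := map_zero _)

theorem restrictMod2_single (T : M.Tope) (n : ℤ) :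
    M.restrictMod2 (Finsupp.single T.signs n) = Finsupp.single T (n : ZMod 2) := by
  rw [← mod2_single]
  exact congrArg M.mod2 (Finsupp.comapDomain_single Tope.signs T n Tope.signs_injective.injOn)

theorem restrictMod2_mapDomain_signs (γ : M.TopeSpace ℤ) :
    M.restrictMod2 (Finsupp.lmapDomain ℤ ℤ (Tope.signs : M.Tope → E → SignType) γ) =
      M.mod2 γ := by
  induction γ using Finsupp.induction_linear with
  | zero => simp
  | add a b ha hb => rw [map_add, map_add, map_add, ha, hb]
  | single T n =>
    rw [Finsupp.lmapDomain_apply, Finsupp.mapDomain_single, restrictMod2_single, mod2_single]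

theorem neg_one_pow_zmod_two (n : ℕ) : (((-1 : ℤ) ^ n : ℤ) : ZMod 2) = 1 := by
  rw [Int.cast_pow, Int.cast_neg, Int.cast_one, show (-1 : ZMod 2) = 1 from rfl, one_pow]

theorem IsCoverChain.restrictMod2_flipSum {X : ℕ → E → SignType} (hX : M.IsCoverChain p X) :
    M.restrictMod2 (flipSum X p) = hX.flipSumMod2 := by
  rw [flipSum, map_sum, flipSumMod2]
  refine Finset.sum_congr rfl fun S _ => ?_
  have := M.restrictMod2_single (hX.isTope_flip S).toTope ((-1) ^ S.card)
  rwa [neg_one_pow_zmod_two] at this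

/-- Generation by flip sums is applied to an integral lift; only the resulting combination is
reduced mod 2. -/
theorem dualDegreeMod2_le_kalinin [Finite E] (M : OrientedMatroid E)
    (hl : ∀ e, ¬ M.InClosure ∅ e) (p : ℕ) : M.dualDegreeMod2 p ≤ M.kalinin p := by
  rintro _ ⟨γ, hγ, rfl⟩
  rw [← restrictMod2_mapDomain_signs]
  have h := M.lowAnnihilator_le_flipSpan p (mapDomain_signs_mem_lowAnnihilator hγ)
  refine Submodule.span_induction (p := fun x _ => M.restrictMod2 x ∈ M.kalinin p)
    ?_ ?_ ?_ ?_ h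
  · rintro _ ⟨X, hX, rfl⟩
    rw [hX.restrictMod2_flipSum]
    exact ⟨_, hX.isKalininWitness hl⟩
  · rw [map_zero]
    exact Submodule.zero_mem _
  · intro x y _ _ hx hy
    rw [map_add]
    exact Submodule.add_mem _ hx hy
  · intro a x _ hx
    rw [map_zsmul]
    exact zsmul_mem hx a

end DualDegree

/-! ### Complete flags as cover chains -/

section Flags

theorem signVec_ne_zero {E : Type*} (v : E → ZMod 2) (e : E) : signVec v e ≠ 0 := by
  unfold signVec
  split_ifs <;> decide

variable {E : Type*} [Finite E] {M : OrientedMatroid E}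

/-- The flats `F_{min i p}` of a complete flag, indexed by natural numbers. -/
def CompleteFlag.truncFlat (F : M.CompleteFlag) {p : ℕ} (hp : p ≤ M.rank) (i : ℕ) : Set E :=
  F.flat ⟨min i p, by omega⟩

/-- The covectors `T_v \ F_{min i p}`. -/
noncomputable def CompleteFlag.covectorSeq (F : M.CompleteFlag) (v : E → ZMod 2) {p : ℕ}
    (hp : p ≤ M.rank) (i : ℕ) : E → SignType :=
  signDelete (signVec v) (F.truncFlat hp i)

theorem CompleteFlag.covectorSeq_eq_zero_iff (F : M.CompleteFlag) (v : E → ZMod 2) {p : ℕ}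
    (hp : p ≤ M.rank) (i : ℕ) (e : E) : F.covectorSeq v hp i e = 0 ↔ e ∈ F.truncFlat hp i := by
  by_cases h : e ∈ F.truncFlat hp i <;> simp [covectorSeq, signDelete, h, signVec_ne_zero]

theorem CompleteFlag.eRk_add_one_le (F : M.CompleteFlag) {i j : Fin (M.rank + 1)} (h : i < j) :
    (M.underlyingMatroid.eRk (F.flat i)).toNat + 1 ≤
      (M.underlyingMatroid.eRk (F.flat j)).toNat := by
  obtain ⟨hsub, hne⟩ := F.strictMono h
  obtain ⟨e, he, he'⟩ := Set.not_subset.1 hne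
  have := add_one_le_eRk (M := M) hsub he (by rwa [(F.isFlat i).closure])
  rw [← ENat.natCast_toNat (eRk_ne_top (M := M) (F.flat i)),
    ← ENat.natCast_toNat (eRk_ne_top (M := M) (F.flat j))] at this
  exact_mod_cast this

theorem CompleteFlag.eRk_add_sub_le (F : M.CompleteFlag) {i j : ℕ} (hij : i ≤ j)
    (hj : j < M.rank + 1) :
    (M.underlyingMatroid.eRk (F.flat ⟨i, by omega⟩)).toNat + (j - i) ≤
      (M.underlyingMatroid.eRk (F.flat ⟨j, hj⟩)).toNat := by
  induction j, hij using Nat.le_induction with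
  | base => simp
  | succ j hij ih =>
    have h1 := ih (by omega)
    have h2 := F.eRk_add_one_le (i := ⟨j, by omega⟩) (j := ⟨j + 1, hj⟩) (by simp)
    omega

/-- Each of the `d` strict inclusions raises the rank by at least one, while the total rise is at
most `d`; so every rise is exactly one. -/
theorem CompleteFlag.toNat_eRk (F : M.CompleteFlag) {i : ℕ} (hi : i < M.rank + 1) :
    (M.underlyingMatroid.eRk (F.flat ⟨i, hi⟩)).toNat = i := by
  have h1 := F.eRk_add_sub_le (Nat.zero_le i) hi
  have h2 := F.eRk_add_sub_le (i := i) (j := M.rank) (by omega) (by omega)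
  have h3 : (M.underlyingMatroid.eRk (F.flat ⟨M.rank, by omega⟩)).toNat ≤ M.rank :=
    ENat.toNat_le_toNat (M.underlyingMatroid.eRk_le_eRank _) (by
      rw [Matroid.eRank_def]
      exact eRk_ne_top _)
  omega

theorem CompleteFlag.inClosure_insert (F : M.CompleteFlag) {i : ℕ} (hi : i + 1 < M.rank + 1)
    {e f : E} (he : e ∉ F.flat ⟨i, by omega⟩) (he' : e ∈ F.flat ⟨i + 1, hi⟩)
    (hf : f ∈ F.flat ⟨i + 1, hi⟩) : M.InClosure (insert e (F.flat ⟨i, by omega⟩)) f := by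
  have hsub : F.flat ⟨i, by omega⟩ ⊆ F.flat ⟨i + 1, hi⟩ := F.strictMono.monotone (by simp)
  rw [← mem_closure_underlyingMatroid_iff, closure_eq_closure_of_eRk_le
    (Set.insert_subset he' hsub), (F.isFlat _).closure]
  · exact hf
  · rw [Matroid.eRk_insert_eq_add_one ⟨Set.mem_univ e, by rwa [(F.isFlat _).closure]⟩,
      ← ENat.natCast_toNat (eRk_ne_top (M := M) (F.flat ⟨i, by omega⟩)),
      ← ENat.natCast_toNat (eRk_ne_top (M := M) (F.flat ⟨i + 1, hi⟩)), F.toNat_eRk, F.toNat_eRk]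
    norm_cast

theorem CompleteFlag.isCoverChain (F : M.CompleteFlag) {v : E → ZMod 2}
    (hv : F.IsFlagTope (signVec v)) {p : ℕ} (hp : p ≤ M.rank) :
    M.IsCoverChain p (F.covectorSeq v hp) := by
  have hzero := F.covectorSeq_eq_zero_iff v hp
  have htr : ∀ i (hi : i ≤ p), F.truncFlat hp i = F.flat ⟨i, by omega⟩ := by
    intro i hi
    simp only [truncFlat, min_eq_left hi]
  refine ⟨?_, fun i => hv.2 _, ?_, ?_, ?_, ?_⟩
  · have : F.covectorSeq v hp 0 = signVec v := by
      funext e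
      simp [covectorSeq, signDelete, htr 0 (Nat.zero_le p), F.flat_zero]
    rw [this]
    exact hv.1
  · intro i e he
    have h1 : e ∉ F.truncFlat hp (i + 1) := fun h => he ((hzero _ e).2 h)
    have h2 : e ∉ F.truncFlat hp i := fun h => h1 (F.strictMono.monotone (by
      rw [Fin.le_def]
      exact min_le_min_right p (Nat.le_succ i)) h)
    simp [covectorSeq, signDelete, h1, h2]
  · intro i hi
    obtain ⟨-, hne⟩ := F.strictMono
      (show (⟨i, by omega⟩ : Fin (M.rank + 1)) < ⟨i + 1, by omega⟩ by simp)
    obtain ⟨e, he, he'⟩ := Set.not_subset.1 hne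
    refine ⟨e, fun h => he' ?_, ?_⟩
    · rwa [hzero, htr i hi.le] at h
    · rwa [hzero, htr (i + 1) hi]
  · intro i hi e he he' f hf
    have hset : {g | F.covectorSeq v hp i g = 0} = F.flat ⟨i, by omega⟩ := by
      ext g
      rw [Set.mem_ofPred_eq, hzero, htr i hi.le]
    rw [Ne, hzero, htr i hi.le] at he
    rw [hzero, htr (i + 1) hi] at he' hf
    rw [hset]
    exact F.inClosure_insert (by omega) he he' hf
  · intro i hi
    simp only [covectorSeq, truncFlat, min_eq_right hi, min_self]

/-- Adding the indicator vector of `F_{i+1} \ F_i` to the exponent reverses precisely the signs of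
step `i`. -/
theorem CompleteFlag.flip_covectorSeq (F : M.CompleteFlag) {v : E → ZMod 2}
    (hv : F.IsFlagTope (signVec v)) {p : ℕ} (hp : p ≤ M.rank) (S : Finset (Fin M.rank))
    (hS : ∀ i ∈ S, (i : ℕ) < p) :
    flip (F.covectorSeq v hp) (S.image Fin.val) = signVec (F.point v S) := by
  have hX := F.isCoverChain hv hp
  have hz : ∀ a : ZMod 2, a = 0 ∨ a = 1 := by decide
  classical
  induction S using Finset.induction_on with
  | empty =>
    funext e
    simp [flip_empty, covectorSeq, truncFlat, signDelete, point, F.flat_zero]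
  | insert i S hi ih =>
    have hip := hS i (by simp)
    have hpt : F.point v (insert i S) = F.point v S + F.step i := by
      simp only [point, Finset.sum_insert hi]
      abel
    have hi' : (i : ℕ) ∉ S.image Fin.val := by
      simpa [Fin.val_inj] using hi
    funext e
    rw [Finset.image_insert, hX.signAntitone.flip_insert hi', hpt,
      ih fun j hj => hS j (by simp [hj])]
    simp only [ne_eq, F.covectorSeq_eq_zero_iff]
    have h1 : F.truncFlat hp i = F.flat i.castSucc := by
      simp only [truncFlat, min_eq_left hip.le]
      rfl
    have h2 : F.truncFlat hp (i + 1) = F.flat i.succ := by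
      simp only [truncFlat, min_eq_left (Nat.succ_le_of_lt hip)]
      rfl
    rw [h1, h2]
    by_cases he1 : e ∈ F.flat i.castSucc <;> by_cases he2 : e ∈ F.flat i.succ <;>
      rcases hz (F.point v S e) with h | h <;>
      simp [signVec, step, he1, he2, h] <;> decide

theorem sum_prefixSubsets {A : Type*} [AddCommMonoid A] {d p : ℕ} (hp : p ≤ d)
    (f : Finset ℕ → A) :
    ∑ S ∈ prefixSubsets d p, f (S.image Fin.val) = ∑ S ∈ (Finset.range p).powerset, f S := by
  have hr : Finset.range p =
      (Finset.univ.filter fun i : Fin d => (i : ℕ) < p).image Fin.val := by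
    ext i
    simp only [Finset.mem_range, Finset.mem_image, Finset.mem_filter, Finset.mem_univ, true_and]
    exact ⟨fun h => ⟨⟨i, by omega⟩, h, rfl⟩, by rintro ⟨j, h, rfl⟩; exact h⟩
  rw [hr, Finset.powerset_image,
    Finset.sum_image (Finset.image_injective Fin.val_injective).injOn, prefixSubsets]

theorem lt_of_mem_prefixSubsets {d p : ℕ} {S : Finset (Fin d)} (hS : S ∈ prefixSubsets d p)
    {i : Fin d} (hi : i ∈ S) : (i : ℕ) < p := by
  simpa using Finset.mem_powerset.1 hS hi

theorem CompleteFlag.mod2_prefixChain (F : M.CompleteFlag) {v : E → ZMod 2}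
    (hv : F.IsFlagTope (signVec v)) {p : ℕ} (hp : p ≤ M.rank) :
    M.mod2 (F.prefixChain hv p) = (F.isCoverChain hv hp).flipSumMod2 := by
  rw [IsCoverChain.flipSumMod2, ← sum_prefixSubsets hp, prefixChain, map_sum]
  refine Finset.sum_congr rfl fun S hS => ?_
  have h := F.flip_covectorSeq hv hp S fun i hi => lt_of_mem_prefixSubsets hS hi
  have hT : (F.isFlagTope_point hv S).1.toTope =
      ((F.isCoverChain hv hp).isTope_flip (S.image Fin.val)).toTope := Subtype.ext h.symm
  have h1 := mod2_single (F.isFlagTope_point hv S).1.toTope ((-1) ^ S.card)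
  rw [neg_one_pow_zmod_two, hT] at h1
  rw [← h1, ← hT]
  rfl

theorem CompleteFlag.halfChain_eq_topChain (F : M.CompleteFlag) {v : E → ZMod 2}
    (hv : F.IsFlagTope (signVec v)) (q : Fin M.rank) :
    (F.isCoverChain hv (p := q + 1) q.2).halfChain (q + 1) = F.topChain hv q := by
  have hX := F.isCoverChain hv (p := q + 1) q.2
  have hr : (Finset.range ((q : ℕ) + 1)).erase (q + 1 - 1) = Finset.range q := by
    ext i
    simp only [Finset.mem_erase, Finset.mem_range]
    omega
  rw [IsCoverChain.halfChain, hr, ← sum_prefixSubsets q.2.le, topChain]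
  refine Finset.sum_congr rfl fun S hS => ?_
  have h := F.flip_covectorSeq hv (p := q + 1) q.2 S
    fun i hi => (lt_of_mem_prefixSubsets hS hi).trans (Nat.lt_succ_self _)
  have hface : flipFace (F.covectorSeq v (p := q + 1) q.2) (q + 1) (S.image Fin.val) =
      signDelete (signVec v) (F.flat q.succ) := by
    -- All flipped steps lie below `q`, hence inside `F_{q+1}`, so every cell of the sum has the
    -- same covector `T_v \ F_{q+1}`.
    rw [hX.signAntitone.flipFace_congr (S' := ∅)]
    · have h2 : F.truncFlat (p := q + 1) q.2 (q + 1) = F.flat q.succ := by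
        simp only [truncFlat, min_self]
        rfl
      rw [← h2]
      funext e
      by_cases he : e ∈ F.truncFlat (p := q + 1) q.2 (q + 1)
      · rw [flipFace_of_eq_zero ((F.covectorSeq_eq_zero_iff _ _ _ _).2 he)]
        simp [signDelete, he]
      · have he' : F.covectorSeq v (p := q + 1) q.2 (q + 1) e ≠ 0 := fun h =>
          he ((F.covectorSeq_eq_zero_iff _ _ _ _).1 h)
        rw [flipFace_of_ne_zero he', flip_empty, ← hX.signAntitone.signLE (Nat.zero_le _) e he']
        rfl
    · intro j hj
      simp only [Finset.mem_image, Finset.notMem_empty, iff_false]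
      rintro ⟨i, hi, rfl⟩
      have := lt_of_mem_prefixSubsets hS hi
      omega
  congr 1
  refine SalvettiCell.ext hface ?_
  change signComp (flipFace _ _ _) (flip _ _) = signComp _ _
  rw [hface, h]

end Flags

theorem not_inClosure_empty_of_loopless {E : Type*} [Finite E] {M : OrientedMatroid E}
    (hM : M.underlyingMatroid.Loopless) (e : E) : ¬ M.InClosure ∅ e := by
  rw [← mem_closure_underlyingMatroid_iff]
  have := hM.loops_eq_empty
  rw [Matroid.loops] at this
  simp [this]

end OrientedMatroid

theorem mainTheorem6 {E : Type*} [Finite E] (M : OrientedMatroid E)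
    (hM : M.underlyingMatroid.Loopless) :
    (∀ (F : M.CompleteFlag) (v : E → ZMod 2) (hv : F.IsFlagTope (signVec v)) (p : ℕ),
      p ≤ M.rank →
        M.mod2 (F.prefixChain hv p) ∈ M.kalinin p ∧
        ∃ β : ℕ → M.SalvettiChain,
          M.IsKalininWitness (M.mod2 (F.prefixChain hv p)) p β ∧
          ∀ q : Fin M.rank, (q : ℕ) + 1 = p → β p = F.topChain hv q) ∧
    ∀ p : ℕ, M.dualDegreeMod2 p ≤ M.kalinin p := by
  have hl := OrientedMatroid.not_inClosure_empty_of_loopless hM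
  refine ⟨fun F v hv p hp => ?_, M.dualDegreeMod2_le_kalinin hl⟩
  have hw := (F.isCoverChain hv hp).isKalininWitness hl
  rw [← F.mod2_prefixChain hv hp] at hw
  refine ⟨⟨_, hw⟩, _, hw, ?_⟩
  rintro q rfl
  exact F.halfChain_eq_topChain hv q
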